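/- Let $K$ be an algebraically closed field, $K_0\subset K$ a perfect subfield, and let $n,d$ be integers with $2\le d<n$, $\gcd(n,d)=1$ and $\operatorname{char}(K)\nmid d$. For a polynomial $f(x)\in K[x]$ of degree $n$ without repeated roots (in $K$), let $\mathcal C_{f,d}$ be the smooth projective model over $K$ of the affine curve $y^d=f(x)$, let $\mathcal O_{f,d}$ be its unique point at infinity (the only pole of the function $x$), and embed $\mathcal C_{f,d}$ into its Jacobian by sending a point $\mathcal P$ to the class of the divisor $(\mathcal P)-(\mathcal O_{f,d})$; the order of a point $\mathcal P$ is the order of this class. If $f(x)\in K_0[x]$, the $K_0$-points of $\mathcal C_{f,d}$ are $\mathcal O_{f,d}$ and the affine points $(a,b)$ with $a,b\in K_0$, $b^d=f(a)$. An integer $m>1$ is called $(n,d)$-reachable over $K_0$ if there exists a polynomial $f(x)\in K_0[x]$ of degree $n$ without repeated roots such that $\mathcal C_{f,d}$ has a $K_0$-point of order $m$. Put $$\ell_0:=\left\lfloor\frac{n+d}{d}\right\rfloor,\qquad m_0:=d\,\ell_0 .$$ Assume that $n-m_0+\ell_0=0$. Then: (i) $m_0$ is $(n,d)$-reachable over $K_0$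 if and only if $\operatorname{char}(K_0)$ does not divide $\ell_0$. (ii) If $\operatorname{char}(K_0)$ does not divide $\ell_0$, then $f_0(x):=-x^{m_0}+(x^{\ell_0}+1)^d\in K_0[x]$ is a polynomial of degree $n$ without repeated roots, and $\mathcal Q_0=(0,1)$ is a $K_0$-point of order $m_0$ on $\mathcal C_{f_0,d}$. (iii) If $\operatorname{char}(K_0)$ does not divide $\ell_0$ and $f(x)\in K_0[x]$ is a polynomial of degree $n$ without repeated roots such that $\mathcal C_{f,d}$ has a $K_0$-point $\mathcal P$ of order $m_0$, then there is an isomorphism of curves $\mathcal C_{f,d}\to\mathcal C_{f_0,d}$ over $K$ which sends $\mathcal O_{f,d}$ to $\mathcal O_{f_0,d}$ and $\mathcal P$ to $\mathcal Q_0$. -/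

import Mathlib

open Polynomial
open scoped WithZero

noncomputable section

/-- The integer `ℓ₀ = [(n+d)/d]`. -/
def ellZero (n d : ℕ) : ℕ := (n + d) / d

/-- The integer `m₀ = d * ℓ₀`. -/
def mZero (n d : ℕ) : ℕ := d * ellZero n d

namespace CyclicCover

variable {K : Type*} [Field K]

/-- The coordinate ring `K[x][y] / (y ^ d - f(x))` of the plane affine curve `y ^ d = f(x)`. -/
abbrev CoordRing (f : K[X]) (d : ℕ) : Type _ :=
  AdjoinRoot (X ^ d - C f : K[X][X])

/-- The field of rational functions on the curve `y ^ d = f(x)`: the fraction field of the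
coordinate ring (which is a domain in the situation of interest). -/
abbrev FunField (f : K[X]) (d : ℕ) : Type _ := FractionRing (CoordRing f d)

/-- The rational function `x`. -/
def xFun (f : K[X]) (d : ℕ) : FunField f d :=
  algebraMap (CoordRing f d) (FunField f d) (AdjoinRoot.of _ X)

/-- The rational function `y`. -/
def yFun (f : K[X]) (d : ℕ) : FunField f d :=
  algebraMap (CoordRing f d) (FunField f d) (AdjoinRoot.root _)

/-- The `K`-points (`K` algebraically closed) of the smooth projective model of `y ^ d = f(x)`:
the normalized discrete valuations of the function field that are trivial on `K`. The valuation
is written multiplicatively: a function `h` vanishes at the point iff its value is `< 1`, and has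
a pole there iff its value is `> 1`. -/
@[ext]
structure Point (f : K[X]) (d : ℕ) where
  val : Valuation (FunField f d) ℤᵐ⁰
  surjective_val : Function.Surjective val
  val_const : ∀ c : K, c ≠ 0 → val (algebraMap K (FunField f d) c) = 1

variable {f g : K[X]} {d : ℕ}

/-- `O` is the point at infinity: the only pole of the function `x`. -/
def Point.IsInfinity (O : Point f d) : Prop :=
  ∀ P : Point f d, 1 < P.val (xFun f d) ↔ P = O

/-- `Q` is the affine point `(a, b)`: the only point at which `x - a` and `y - b` both vanish. -/
def Point.IsAffine (Q : Point f d) (a b : K) : Prop :=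
  ∀ P : Point f d,
    (P.val (xFun f d - algebraMap K _ a) < 1 ∧ P.val (yFun f d - algebraMap K _ b) < 1) ↔ P = Q

/-- `P` is a `K₀`-point: either the point at infinity or an affine point with
coordinates in `K₀`. -/
def Point.IsRational (K₀ : Type*) [Field K₀] [Algebra K₀ K] (P : Point f d) : Prop :=
  P.IsInfinity ∨ ∃ a b : K₀, P.IsAffine (algebraMap K₀ K a) (algebraMap K₀ K b)

/-- The order of vanishing at `P` of a nonzero rational function. -/
def Point.ord (P : Point f d) (h : (FunField f d)ˣ) : ℤ :=
  -WithZero.log (P.val (h : FunField f d))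

theorem Point.val_unit_ne_zero (P : Point f d) (h : (FunField f d)ˣ) :
    P.val (h : FunField f d) ≠ 0 :=
  (h.isUnit.map P.val).ne_zero

theorem Point.ord_one (P : Point f d) : P.ord 1 = 0 := by
  simp [Point.ord]

theorem Point.ord_mul (P : Point f d) (h₁ h₂ : (FunField f d)ˣ) :
    P.ord (h₁ * h₂) = P.ord h₁ + P.ord h₂ := by
  simp only [Point.ord, Units.val_mul, map_mul,
    WithZero.log_mul (P.val_unit_ne_zero h₁) (P.val_unit_ne_zero h₂)]
  ring

theorem Point.ord_inv (P : Point f d) (h : (FunField f d)ˣ) : P.ord h⁻¹ = -P.ord h := by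
  have := P.ord_mul h h⁻¹
  rw [mul_inv_cancel, P.ord_one] at this
  linarith

variable (f d)

/-- Divisors on the curve. -/
abbrev Divisor : Type _ := Point f d →₀ ℤ

/-- Divisors of degree zero (every point has degree one, as `K` is algebraically closed). -/
def divisorZero : AddSubgroup (Divisor f d) :=
  (Finsupp.degree (σ := Point f d) (R := ℤ)).ker

/-- Principal divisors, i.e. divisors of nonzero rational functions. -/
def principalDivisor : AddSubgroup (Divisor f d) where
  carrier := {D | ∃ h : (FunField f d)ˣ, ∀ P : Point f d, D P = P.ord h}
  zero_mem' := ⟨1, fun P => by simp [P.ord_one]⟩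
  add_mem' := by
    rintro D₁ D₂ ⟨h₁, H₁⟩ ⟨h₂, H₂⟩
    exact ⟨h₁ * h₂, fun P => by simp [H₁, H₂, P.ord_mul]⟩
  neg_mem' := by
    rintro D ⟨h, H⟩
    exact ⟨h⁻¹, fun P => by simp [H, P.ord_inv]⟩

/-- The group of `K`-points of the Jacobian: divisor classes of degree zero. -/
abbrev Jac : Type _ :=
  divisorZero f d ⧸ (principalDivisor f d).addSubgroupOf (divisorZero f d)

variable {f d}

/-- The class of the divisor `(P) - (O)` in the Jacobian. -/
def jacClass (O P : Point f d) : Jac f d :=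
  QuotientAddGroup.mk
    ⟨Finsupp.single P 1 - Finsupp.single O 1, by simp [divisorZero, AddMonoidHom.mem_ker]⟩

/-- `P` has order `m` in the Jacobian, where the curve is embedded in its Jacobian by
`P ↦ (P) - (O)` with `O` the point at infinity. -/
def Point.HasOrder (P : Point f d) (m : ℕ) : Prop :=
  ∃ O : Point f d, O.IsInfinity ∧ addOrderOf (jacClass O P) = m

/-- Isomorphisms of curves over `K` from the smooth projective model of `y ^ d = f(x)` to that of
`y ^ d = g(x)`: a bijection on points together with the pullback isomorphism of function fields. -/
structure CurveIso (f g : K[X]) (d : ℕ) where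
  toEquiv : Point f d ≃ Point g d
  pullback : FunField g d ≃ₐ[K] FunField f d
  val_pullback : ∀ (P : Point f d) (h : FunField g d), (toEquiv P).val h = P.val (pullback h)

/-- The polynomial has degree `n` and no repeated roots in `K`. -/
def IsAdmissible (K : Type*) [Field K] {K₀ : Type*} [Field K₀] [Algebra K₀ K]
    (n : ℕ) (f : K₀[X]) : Prop :=
  f.natDegree = n ∧ (f.map (algebraMap K₀ K)).roots.Nodup

/-- `m` is `(n, d)`-reachable over `K₀` (`K` being an algebraically closed field over `K₀`). -/
def IsReachable (K₀ K : Type*) [Field K₀] [Field K] [Algebra K₀ K] (n d m : ℕ) : Prop :=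
  1 < m ∧ ∃ f : K₀[X], IsAdmissible K n f ∧
    ∃ P : Point (f.map (algebraMap K₀ K)) d, P.IsRational K₀ ∧ P.HasOrder m

/-- The polynomial `f₀(x) = -x ^ m₀ + (x ^ ℓ₀ + 1) ^ d`. -/
def fZero (K₀ : Type*) [Field K₀] (n d : ℕ) : K₀[X] :=
  -X ^ mZero n d + (X ^ ellZero n d + 1) ^ d

end CyclicCover

end

/-!
A point `P ≠ O` is killed by `m` in the Jacobian iff some function has divisor `m (P - O)`. Such a
function has no poles at finite distance, so it lies in the coordinate ring
(`IsSuperelliptic.exists_algebraMap_eq`) and is a reduced expression `∑ pᵢ(x) yⁱ` with `i < d`. At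
infinity `x` and `y` have poles of the coprime orders `d` and `n`, so the terms have distinct pole
orders and the pole order of the sum is their maximum (`IsSuperelliptic.exists_isInfinity`).

The hypothesis means `n = (d - 1) ℓ` and `m₀ = d ℓ` with `ℓ = ℓ₀` and `2 ≤ ℓ < d`. A function of pole
order `d ℓ` is then `c y + s(x)`. Here `c ≠ 0`, because a polynomial in `x` vanishes on whole fibres
of `x`, and a ramification point has order dividing `d`. After rescaling the function is `y - v(x)`
with `v` of degree `ℓ`. Any root `α` of `v ^ d - f` gives the zero `(α, v(α))` of this function, so
`a = x(P)` is the only root and `f = v ^ d - (e (x - a) ^ ℓ) ^ d`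
(`IsSuperelliptic.exists_section`, `IsSuperelliptic.eq_pow_sub_pow`). Comparing degrees,
`v = e (x - a) ^ ℓ + b`, so an affine substitution in `x` and a scaling of `y` turn `f` into `f₀`. As
`f` has simple roots, its derivative is nonzero and the characteristic does not divide `ℓ`.

Conversely `y - (x ^ ℓ + 1)` divides `x ^ (d ℓ)` on the curve of `f₀` and has divisor
`d ℓ (Q - O)` with `Q = (0, 1)`. A function realizing a smaller order of `Q` has a pole of order less
than `n`, so it is a polynomial in `x`, which cannot vanish at `Q` only
(`IsSuperelliptic.exists_hasOrder_model`).

Points are valuations. They are constructed from parametrizations by Laurent series that Hensel's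
lemma provides, and a valuation is identified with a constructed one by computing it on the
coordinate ring up to a power and using that both are normalized (`Point.eq_of_val_eq_pow`).
-/

noncomputable section

namespace CyclicCover

variable {K : Type*} [Field K]

/-! ### Valuations and the coordinate ring -/

/-- The hypotheses on `y ^ d = f(x)` used throughout: `f` has degree `n` and simple roots in `K`,
`n` and `d ≥ 2` are coprime, and `d` is invertible in `K`. -/
structure IsSuperelliptic (f : K[X]) (n d : ℕ) : Prop where
  natDegree_eq : f.natDegree = n
  nodup_roots : f.roots.Nodup
  two_le : 2 ≤ d
  coprime : n.Coprime d
  cast_ne_zero : (d : K) ≠ 0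

section Valuation

variable {F : Type*} [CommRing F] [Algebra K F] {v : Valuation F ℤᵐ⁰}

theorem val_algebraMap_le_one (hv : ∀ c : K, c ≠ 0 → v (algebraMap K F c) = 1) (c : K) :
    v (algebraMap K F c) ≤ 1 := by
  by_cases hc : c = 0
  · simp [hc]
  · exact (hv c hc).le

theorem val_aeval_le_one (hv : ∀ c : K, c ≠ 0 → v (algebraMap K F c) = 1) {z : F}
    (hz : v z ≤ 1) (q : K[X]) : v (aeval z q) ≤ 1 := by
  rw [aeval_eq_sum_range]
  refine v.map_sum_le fun i _ => ?_
  rw [Algebra.smul_def, map_mul, map_pow]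
  exact mul_le_one' (val_algebraMap_le_one hv _) (pow_le_one' hz _)

theorem val_le_one_of_val_sub_lt_one (hv : ∀ c : K, c ≠ 0 → v (algebraMap K F c) = 1) {z : F}
    {b : K} (hz : v (z - algebraMap K F b) < 1) : v z ≤ 1 := by
  have := v.map_add_le hz.le (val_algebraMap_le_one hv b)
  simpa using this

/-- If `z` reduces to the constant `b` at a point, then `q(z)` reduces to `q(b)`, to at least the
same order. -/
theorem val_aeval_sub_le (hv : ∀ c : K, c ≠ 0 → v (algebraMap K F c) = 1) {z : F}
    {b : K} (hz : v (z - algebraMap K F b) < 1) (q : K[X]) :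
    v (aeval z q - algebraMap K F (q.eval b)) ≤ v (z - algebraMap K F b) := by
  obtain ⟨r, hr⟩ := X_sub_C_dvd_sub_C_eval (a := b) (p := q)
  have h := congrArg (aeval z) hr
  simp only [map_sub, map_mul, aeval_C, aeval_X] at h
  rw [h, map_mul]
  exact mul_le_of_le_one_right' (val_aeval_le_one hv (val_le_one_of_val_sub_lt_one hv hz) r)

theorem val_aeval_lt_one (hv : ∀ c : K, c ≠ 0 → v (algebraMap K F c) = 1) {z : F}
    {b : K} (hz : v (z - algebraMap K F b) < 1) {q : K[X]} (hq : q.eval b = 0) :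
    v (aeval z q) < 1 := by
  have := val_aeval_sub_le hv hz q
  rw [hq, map_zero, sub_zero] at this
  exact this.trans_lt hz

theorem val_aeval_eq_one (hv : ∀ c : K, c ≠ 0 → v (algebraMap K F c) = 1) {z : F}
    {b : K} (hz : v (z - algebraMap K F b) < 1) {q : K[X]} (hq : q.eval b ≠ 0) :
    v (aeval z q) = 1 := by
  have h := (val_aeval_sub_le hv hz q).trans_lt hz
  rw [← hv _ hq] at h ⊢
  have := v.map_add_eq_of_lt_left h
  simpa using this

theorem eq_of_val_sub_lt_one (hv : ∀ c : K, c ≠ 0 → v (algebraMap K F c) = 1) {z : F}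
    {a b : K} (ha : v (z - algebraMap K F a) < 1) (hb : v (z - algebraMap K F b) < 1) :
    a = b := by
  by_contra h
  have h1 := v.map_sub_lt hb ha
  rw [sub_sub_sub_cancel_left, ← map_sub, hv _ (sub_ne_zero.2 h)] at h1
  exact lt_irrefl _ h1

/-- At a pole of `z` the leading term of `q(z)` dominates. -/
theorem val_aeval_of_one_lt (hv : ∀ c : K, c ≠ 0 → v (algebraMap K F c) = 1) {z : F}
    (hz : 1 < v z) {q : K[X]} (hq : q ≠ 0) : v (aeval z q) = v z ^ q.natDegree := by
  classical
  rw [aeval_eq_sum_range]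
  have hl : v (q.coeff q.natDegree • z ^ q.natDegree) = v z ^ q.natDegree := by
    rw [Algebra.smul_def, map_mul, map_pow, hv _ (by simpa using hq), one_mul]
  rw [v.map_sum_eq_of_lt (j := q.natDegree) (by simp), hl]
  intro i hi
  rw [hl, Algebra.smul_def, map_mul, map_pow]
  simp only [Finset.mem_sdiff, Finset.mem_range, Finset.mem_singleton] at hi
  refine (mul_le_of_le_one_left' (val_algebraMap_le_one hv _)).trans_lt ?_
  exact pow_lt_pow_right₀ hz (by omega)

end Valuation

section CoordRing

variable (f : K[X]) (d : ℕ)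

theorem algebraMap_eq_coordRing (c : K) :
    algebraMap K (FunField f d) c =
      algebraMap (CoordRing f d) (FunField f d) (AdjoinRoot.of _ (C c)) := by
  rw [IsScalarTower.algebraMap_apply K (CoordRing f d) (FunField f d)]
  rfl

theorem algebraMap_of_eq_aeval (s : K[X]) :
    algebraMap (CoordRing f d) (FunField f d) (AdjoinRoot.of _ s) = aeval (xFun f d) s := by
  induction s using Polynomial.induction_on' with
  | add p q hp hq => simp [hp, hq]
  | monomial k c =>
    rw [← C_mul_X_pow_eq_monomial]
    simp [algebraMap_eq_coordRing, xFun]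

theorem yFun_pow : yFun f d ^ d = aeval (xFun f d) f := by
  rw [← algebraMap_of_eq_aeval, yFun, ← map_pow]
  congr 1
  have := AdjoinRoot.eval₂_root (X ^ d - C f : K[X][X])
  simpa [sub_eq_zero] using this

variable {f d}

theorem monic_equation (hd : d ≠ 0) : (X ^ d - C f : K[X][X]).Monic :=
  monic_X_pow_sub_C f hd

theorem exists_mk_eq (hd : d ≠ 0) (A : CoordRing f d) :
    ∃ p : K[X][X], p.natDegree < d ∧ AdjoinRoot.mk _ p = A := by
  obtain ⟨p, rfl⟩ := AdjoinRoot.mk_surjective A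
  have hm := monic_equation (f := f) hd
  refine ⟨p %ₘ (X ^ d - C f), ?_, ?_⟩
  · have := natDegree_modByMonic_lt p hm (fun h => by
      have := congrArg natDegree h
      simp [hd] at this)
    rwa [natDegree_X_pow_sub_C] at this
  · rw [AdjoinRoot.mk_eq_mk, ← dvd_neg, neg_sub]
    exact ⟨p /ₘ (X ^ d - C f), by rw [modByMonic_eq_sub_mul_div, sub_sub_cancel]⟩

theorem algebraMap_mk (p : K[X][X]) :
    algebraMap (CoordRing f d) (FunField f d) (AdjoinRoot.mk _ p) =
      ∑ i ∈ p.support, aeval (xFun f d) (p.coeff i) * yFun f d ^ i := by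
  conv_lhs => rw [p.as_sum_support]
  rw [map_sum, map_sum]
  refine Finset.sum_congr rfl fun i _ => ?_
  rw [← C_mul_X_pow_eq_monomial, map_mul, map_mul, map_pow, map_pow, AdjoinRoot.mk_C,
    AdjoinRoot.mk_X, algebraMap_of_eq_aeval, yFun]

/-- Reduction modulo `x - a`: the fibre of the curve over `a` has coordinate ring
`K[y] / (y ^ d - f(a))`, with basis `1, y, …, y ^ (d - 1)`. -/
theorem exists_eq_mul_add_aeval (hd : d ≠ 0) (A : CoordRing f d) (a : K) :
    ∃ (q : K[X]) (B : CoordRing f d), q.natDegree < d ∧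
      A = AdjoinRoot.of _ (X - C a) * B + aeval (AdjoinRoot.root (X ^ d - C f)) q := by
  obtain ⟨p, hp, rfl⟩ := exists_mk_eq hd A
  have h : C (X - C a) ∣ p - (p.map (evalRingHom a)).map C := by
    rw [C_dvd_iff_dvd_coeff]
    intro i
    simpa using X_sub_C_dvd_sub_C_eval (a := a) (p := p.coeff i)
  obtain ⟨r, hr⟩ := h
  refine ⟨p.map (evalRingHom a), AdjoinRoot.mk _ r, (natDegree_map_le).trans_lt hp, ?_⟩
  rw [sub_eq_iff_eq_add] at hr
  conv_lhs => rw [hr]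
  rw [map_add, map_mul, AdjoinRoot.mk_C]
  congr 1
  generalize p.map (evalRingHom a) = q
  rw [← AdjoinRoot.aeval_eq]
  exact aeval_map_algebraMap K[X] _ q

end CoordRing

/-! ### Points from Laurent series parametrizations -/

namespace IsSuperelliptic

variable {f : K[X]} {n d : ℕ}

theorem d_ne_zero (hf : IsSuperelliptic f n d) : d ≠ 0 := by
  have := hf.two_le; omega

theorem n_ne_zero (hf : IsSuperelliptic f n d) : n ≠ 0 := by
  rintro rfl
  have h1 := hf.two_le
  have h2 := hf.coprime
  simp at h2; omega

theorem ne_zero (hf : IsSuperelliptic f n d) : f ≠ 0 := by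
  rintro rfl
  exact hf.n_ne_zero (by simpa using hf.natDegree_eq.symm)

theorem derivative_eval_ne_zero (hf : IsSuperelliptic f n d) {a : K} (ha : f.eval a = 0) :
    f.derivative.eval a ≠ 0 := by
  classical
  intro h
  have h1 := (one_lt_rootMultiplicity_iff_isRoot hf.ne_zero).2 ⟨ha, h⟩
  rw [← count_roots] at h1
  have := Multiset.nodup_iff_count_le_one.1 hf.nodup_roots a
  omega

variable [IsAlgClosed K]

/-- The equation is Eisenstein at `x - a` for any root `a` of `f`. -/
theorem isDomain (hf : IsSuperelliptic f n d) : IsDomain (CoordRing f d) := by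
  apply AdjoinRoot.isDomain_of_prime
  rw [← irreducible_iff_prime]
  obtain ⟨a, ha⟩ := IsAlgClosed.exists_root f
    (by rw [degree_eq_natDegree hf.ne_zero, hf.natDegree_eq]; exact_mod_cast hf.n_ne_zero)
  have hd := hf.d_ne_zero
  have hm := monic_equation (f := f) hd
  have hdeg : (X ^ d - C f : K[X][X]).degree = d := degree_X_pow_sub_C (by omega) f
  have hP : (Ideal.span {X - C a} : Ideal K[X]).IsPrime := by
    rw [Ideal.span_singleton_prime (X_sub_C_ne_zero a)]
    exact prime_X_sub_C a
  refine irreducible_of_eisenstein_criterion hP ?_ ?_ ?_ ?_ hm.isPrimitive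
  · rw [hm.leadingCoeff]
    exact fun h => hP.ne_top ((Ideal.eq_top_iff_one _).2 h)
  · intro i hi
    rw [hdeg] at hi
    have hi' : i < d := by exact_mod_cast hi
    rw [coeff_sub, coeff_X_pow, if_neg (by omega), zero_sub, coeff_C]
    split_ifs
    · exact neg_mem (Ideal.mem_span_singleton.2 (dvd_iff_isRoot.2 ha))
    · simp
  · rw [hdeg]; exact_mod_cast Nat.pos_of_ne_zero hd
  · rw [Ideal.span_singleton_pow, Ideal.mem_span_singleton, coeff_sub, coeff_X_pow,
      if_neg (by omega), zero_sub, coeff_C_zero, dvd_neg]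
    rintro ⟨q, hq⟩
    apply hf.derivative_eval_ne_zero ha
    rw [hq]
    simp [derivative_mul, derivative_pow]

end IsSuperelliptic

section Laurent

open scoped LaurentSeries PowerSeries

theorem aeval_algebraMap_powerSeries (u : K⟦X⟧) (q : K[X]) :
    aeval (algebraMap K⟦X⟧ K⸨X⸩ u) q = algebraMap K⟦X⟧ K⸨X⸩ (aeval u q) :=
  (hom_eval₂ q (algebraMap K K⟦X⟧) (algebraMap K⟦X⟧ K⸨X⸩) u).symm

theorem valued_powerSeries_le_one (u : K⟦X⟧) :
    (Valued.v (algebraMap K⟦X⟧ K⸨X⸩ u) : ℤᵐ⁰) ≤ 1 :=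
  IsDedekindDomain.HeightOneSpectrum.valuation_le_one _ u

theorem valued_powerSeries_X : (Valued.v (algebraMap K⟦X⟧ K⸨X⸩ PowerSeries.X) : ℤᵐ⁰) =
    WithZero.exp (-1) := by
  simpa using LaurentSeries.valuation_X_pow K 1

theorem valued_powerSeries_eq_one {u : K⟦X⟧} (hu : PowerSeries.constantCoeff u ≠ 0) :
    (Valued.v (algebraMap K⟦X⟧ K⸨X⸩ u) : ℤᵐ⁰) = 1 := by
  obtain ⟨w, hw⟩ := isUnit_iff_exists_inv.1
    ((PowerSeries.isUnit_iff_constantCoeff).2 (isUnit_iff_ne_zero.2 hu))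
  refine le_antisymm (valued_powerSeries_le_one u) ?_
  have h : (Valued.v (algebraMap K⟦X⟧ K⸨X⸩ u) : ℤᵐ⁰) * Valued.v (algebraMap K⟦X⟧ K⸨X⸩ w) = 1 := by
    rw [← map_mul, ← map_mul, hw, map_one, map_one]
  rw [← h]
  exact mul_le_of_le_one_right' (valued_powerSeries_le_one w)

theorem valued_powerSeries_lt_one {u : K⟦X⟧} (hu : PowerSeries.constantCoeff u = 0) :
    (Valued.v (algebraMap K⟦X⟧ K⸨X⸩ u) : ℤᵐ⁰) < 1 := by
  obtain ⟨w, rfl⟩ := PowerSeries.X_dvd_iff.2 hu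
  rw [map_mul, map_mul, valued_powerSeries_X]
  refine (mul_le_of_le_one_right' (valued_powerSeries_le_one w)).trans_lt ?_
  rw [← WithZero.exp_zero, WithZero.exp_lt_exp]
  norm_num

theorem valued_const (c : K) (hc : c ≠ 0) : (Valued.v (algebraMap K K⸨X⸩ c) : ℤᵐ⁰) = 1 :=
  valued_powerSeries_eq_one (u := PowerSeries.C c) (by simpa using hc)

/-- Hensel's lemma for power series: a simple root of the reduction at `t = 0` lifts. -/
theorem exists_powerSeries_root {p : K⟦X⟧[X]} (hp : p.Monic) {c : K}
    (hc : (p.map PowerSeries.constantCoeff).eval c = 0)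
    (hc' : (p.map PowerSeries.constantCoeff).derivative.eval c ≠ 0) :
    ∃ u : K⟦X⟧, p.eval u = 0 ∧ PowerSeries.constantCoeff u = c := by
  have key : ∀ q : K⟦X⟧[X], PowerSeries.constantCoeff (q.eval (PowerSeries.C c)) =
      (q.map PowerSeries.constantCoeff).eval c := fun q => by
    rw [eval_map, eval, hom_eval₂]; simp
  obtain ⟨u, hu, hu'⟩ := HenselianRing.is_henselian (I := Ideal.span {PowerSeries.X}) p hp
    (PowerSeries.C c) (by
      rw [Ideal.mem_span_singleton, PowerSeries.X_dvd_iff, key, hc]) (by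
      apply IsUnit.map
      rw [PowerSeries.isUnit_iff_constantCoeff, key, ← derivative_map]
      exact isUnit_iff_ne_zero.2 hc')
  refine ⟨u, hu, ?_⟩
  rw [Ideal.mem_span_singleton, PowerSeries.X_dvd_iff, map_sub, sub_eq_zero] at hu'
  simpa using hu'

/-- A homomorphism from the function field to Laurent series that carries some function to a
uniformizer determines a point of the curve. -/
def Point.ofRingHom {f : K[X]} {d : ℕ} (ψ : FunField f d →+* K⸨X⸩)
    (hψ : ∀ c : K, ψ (algebraMap K _ c) = algebraMap K _ c)
    (hs : Function.Surjective fun z => (Valued.v (ψ z) : ℤᵐ⁰)) : Point f d where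
  val := (Valued.v : Valuation K⸨X⸩ ℤᵐ⁰).comap ψ
  surjective_val := hs
  val_const c hc := by
    rw [Valuation.comap_apply, hψ]
    exact valued_const c hc

namespace IsSuperelliptic

variable {f : K[X]} {n d : ℕ} [IsAlgClosed K]

/-- A nonconstant parametrization `x = ξ(t)`, `y = η(t)` of the curve by Laurent series extends to
the function field: the kernel on the coordinate ring meets `K[x]` trivially, and the coordinate ring
is integral over `K[x]`. -/
theorem exists_ringHom (hf : IsSuperelliptic f n d) {ξ η : K⸨X⸩}
    (hη : η ^ d = aeval ξ f) (hξ : ∀ c : K, ξ ≠ algebraMap K _ c) :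
    ∃ ψ : FunField f d →+* K⸨X⸩, (∀ c : K, ψ (algebraMap K _ c) = algebraMap K _ c) ∧
      ψ (xFun f d) = ξ ∧ ψ (yFun f d) = η := by
  have := hf.isDomain
  have htr : ∀ s : K[X], aeval ξ s = 0 → s = 0 := by
    intro s hs
    by_contra hne
    have hint : IsIntegral K ξ := (IsAlgebraic.isIntegral ⟨s, hne, hs⟩)
    obtain ⟨c, hc⟩ := minpoly.mem_range_of_degree_eq_one K ξ
      (IsAlgClosed.degree_eq_one_of_irreducible K (minpoly.irreducible hint))
    exact hξ c hc.symm
  let φ : CoordRing f d →+* K⸨X⸩ := AdjoinRoot.lift (aeval ξ : K[X] →ₐ[K] K⸨X⸩).toRingHom η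
    (by simp [eval₂_sub, hη])
  have hφof : ∀ s : K[X], φ (AdjoinRoot.of _ s) = aeval ξ s := fun s => by simp [φ]
  have hφ : Function.Injective φ := by
    have : Module.Finite K[X] (CoordRing f d) :=
      (monic_equation (f := f) hf.d_ne_zero).finite_adjoinRoot
    rw [RingHom.injective_iff_ker_eq_bot]
    apply Ideal.eq_bot_of_comap_eq_bot (R := K[X])
    rw [eq_bot_iff]
    intro s hs
    exact htr s ((hφof s).symm.trans hs)
  refine ⟨IsFractionRing.lift hφ, fun c => ?_, ?_, ?_⟩
  · rw [algebraMap_eq_coordRing, IsFractionRing.lift_algebraMap, hφof, aeval_C]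
  · rw [xFun, IsFractionRing.lift_algebraMap, hφof, aeval_X]
  · rw [yFun, IsFractionRing.lift_algebraMap]
    simp [φ]

theorem _root_.Valuation.surjective_of_exp_neg_one {F : Type*} [Field F] {v : Valuation F ℤᵐ⁰}
    {z : F} (hz : v z = WithZero.exp (-1)) : Function.Surjective v := by
  intro γ
  by_cases h : γ = 0
  · exact ⟨0, by simp [h]⟩
  refine ⟨z ^ (-WithZero.log γ), ?_⟩
  rw [map_zpow₀, hz, ← WithZero.exp_zsmul, smul_eq_mul, mul_neg, mul_one, neg_neg,
    WithZero.exp_log h]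

/-- A parametrization in which some `(x - a) ^ i * y ^ j` has order one in `t` defines a point, since
its valuation is then normalized. -/
theorem exists_point_of_laurent (hf : IsSuperelliptic f n d) {ξ η : K⸨X⸩}
    (hη : η ^ d = aeval ξ f) (hξ : ∀ c : K, ξ ≠ algebraMap K _ c) {a : K} {i j : ℤ}
    (hij : Valued.v ((ξ - algebraMap K _ a) ^ i * η ^ j) = (WithZero.exp (-1) : ℤᵐ⁰)) :
    ∃ P : Point f d, P.val (xFun f d) = Valued.v ξ ∧ P.val (yFun f d) = Valued.v η ∧
      (∀ c, P.val (xFun f d - algebraMap K _ c) = Valued.v (ξ - algebraMap K _ c)) ∧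
      (∀ c, P.val (yFun f d - algebraMap K _ c) = Valued.v (η - algebraMap K _ c)) := by
  have := hf.isDomain
  obtain ⟨ψ, h1, h2, h3⟩ := hf.exists_ringHom hη hξ
  refine ⟨Point.ofRingHom ψ h1 ?_, ?_, ?_, fun c => ?_, fun c => ?_⟩
  · refine Valuation.surjective_of_exp_neg_one (v := (Valued.v : Valuation K⸨X⸩ ℤᵐ⁰).comap ψ)
      (z := (xFun f d - algebraMap K _ a) ^ i * yFun f d ^ j) ?_
    rw [Valuation.comap_apply, map_mul, map_zpow₀, map_zpow₀, map_sub, h1, h2, h3, hij]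
  all_goals simp only [Point.ofRingHom, Valuation.comap_apply, map_sub, h1, h2, h3]

end IsSuperelliptic

end Laurent

/-! ### Existence of points -/

section

open scoped LaurentSeries PowerSeries

theorem ne_algebraMap_of_valued {ξ : K⸨X⸩} {q : K[X]} {k : ℤ} (hk : k ≠ 0)
    (h : Valued.v (aeval ξ q) = (WithZero.exp k : ℤᵐ⁰)) (c : K) : ξ ≠ algebraMap K _ c := by
  rintro rfl
  rw [aeval_algebraMap_apply_eq_algebraMap_eval] at h
  by_cases hc : q.eval c = 0
  · rw [hc, map_zero, map_zero] at h
    exact WithZero.exp_ne_zero h.symm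
  · rw [valued_const _ hc] at h
    exact hk (WithZero.exp_eq_one.1 h.symm)

namespace IsSuperelliptic

variable {f : K[X]} {n d : ℕ}

variable [IsAlgClosed K]

/-- Above a point `a` at which `f` does not vanish, `x - a` is a uniformizer. -/
theorem exists_point_unramified (hf : IsSuperelliptic f n d) {a b : K} (hb : b ≠ 0)
    (hab : b ^ d = f.eval a) :
    ∃ P : Point f d, P.val (xFun f d - algebraMap K _ a) = WithZero.exp (-1) ∧
      P.val (yFun f d - algebraMap K _ b) < 1 := by
  have hd := hf.d_ne_zero
  let ξ₀ : K⟦X⟧ := PowerSeries.C a + PowerSeries.X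
  have hcc : PowerSeries.constantCoeff (aeval ξ₀ f) = f.eval a := by
    rw [aeval_def, hom_eval₂]
    simp only [ξ₀, map_add, PowerSeries.constantCoeff_C, PowerSeries.constantCoeff_X, add_zero]
    exact congrArg (eval₂ · a f) (RingHom.ext fun c => PowerSeries.constantCoeff_C c)
  obtain ⟨u, hu, hub⟩ := exists_powerSeries_root (K := K) (c := b)
    (monic_X_pow_sub_C (aeval ξ₀ f) hd) (by simp [hcc, hab])
    (by simpa [derivative_X_pow, hf.cast_ne_zero] using pow_ne_zero _ hb)
  have hx : algebraMap K⟦X⟧ K⸨X⸩ ξ₀ - algebraMap K _ a = algebraMap K⟦X⟧ K⸨X⸩ PowerSeries.X := by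
    rw [sub_eq_iff_eq_add, add_comm]
    exact map_add _ _ _
  have hη : algebraMap K⟦X⟧ K⸨X⸩ u ^ d = aeval (algebraMap K⟦X⟧ K⸨X⸩ ξ₀) f := by
    rw [aeval_algebraMap_powerSeries, ← map_pow]
    congr 1
    simpa [sub_eq_zero] using hu
  have hξ : Valued.v (aeval (algebraMap K⟦X⟧ K⸨X⸩ ξ₀) (X - C a)) = (WithZero.exp (-1) : ℤᵐ⁰) := by
    rw [map_sub, aeval_X, aeval_C, hx, valued_powerSeries_X]
  obtain ⟨P, -, -, h3, h4⟩ := hf.exists_point_of_laurent hη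
    (ne_algebraMap_of_valued (by norm_num) hξ) (a := a) (i := 1) (j := 0)
    (by rw [zpow_one, zpow_zero, mul_one, hx, valued_powerSeries_X])
  refine ⟨P, by rw [h3, hx, valued_powerSeries_X], ?_⟩
  rw [h4]
  have : algebraMap K⟦X⟧ K⸨X⸩ u - algebraMap K _ b =
      algebraMap K⟦X⟧ K⸨X⸩ (u - PowerSeries.C b) := (map_sub _ _ _).symm
  rw [this]
  exact valued_powerSeries_lt_one (by simp [hub])

/-- Above a root of `f` there is a point at which `y` is a uniformizer. -/
theorem exists_point_ramified (hf : IsSuperelliptic f n d) {a : K} (ha : f.eval a = 0) :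
    ∃ P : Point f d, P.val (xFun f d - algebraMap K _ a) < 1 ∧
      P.val (yFun f d) = WithZero.exp (-1) := by
  have hd := hf.d_ne_zero
  have hlc : f.leadingCoeff ≠ 0 := leadingCoeff_ne_zero.2 hf.ne_zero
  have hn : 0 < f.degree := by
    rw [degree_eq_natDegree hf.ne_zero, hf.natDegree_eq]
    exact_mod_cast Nat.pos_of_ne_zero hf.n_ne_zero
  -- the equation `f(ξ) = t ^ d`, made monic
  let p : K⟦X⟧[X] := ((C f.leadingCoeff⁻¹ * f).map PowerSeries.C) -
    C (PowerSeries.C f.leadingCoeff⁻¹ * PowerSeries.X ^ d)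
  have hp : p.Monic := by
    have h1 : (C f.leadingCoeff⁻¹ * f).Monic := by
      rw [mul_comm]; exact monic_mul_leadingCoeff_inv hf.ne_zero
    refine (h1.map _).sub_of_left ?_
    refine degree_C_le.trans_lt ?_
    rw [degree_map_eq_of_injective PowerSeries.C_injective, degree_C_mul (inv_ne_zero hlc)]
    exact hn
  have hpm : p.map PowerSeries.constantCoeff = C f.leadingCoeff⁻¹ * f := by
    have h1 : (PowerSeries.constantCoeff (R := K)).comp PowerSeries.C = RingHom.id K :=
      RingHom.ext fun c => PowerSeries.constantCoeff_C c
    have h2 : PowerSeries.constantCoeff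
        (PowerSeries.C f.leadingCoeff⁻¹ * PowerSeries.X ^ d) = (0 : K) := by
      rw [map_mul, map_pow, PowerSeries.constantCoeff_X, zero_pow hd, mul_zero]
    rw [Polynomial.map_sub, Polynomial.map_map, h1, Polynomial.map_id, map_C, h2, C_0, sub_zero]
  obtain ⟨u, hu, hub⟩ := exists_powerSeries_root hp (c := a) (by rw [hpm]; simp [ha])
    (by rw [hpm]; simpa [derivative_mul, hlc] using hf.derivative_eval_ne_zero ha)
  have hη : algebraMap K⟦X⟧ K⸨X⸩ PowerSeries.X ^ d = aeval (algebraMap K⟦X⟧ K⸨X⸩ u) f := by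
    rw [aeval_algebraMap_powerSeries, ← map_pow]
    congr 1
    rw [eval_sub, sub_eq_zero, eval_C, Polynomial.map_mul, map_C, eval_mul, eval_C, eval_map] at hu
    exact (mul_left_cancel₀ (by simpa using hlc) hu).symm
  have hξ : Valued.v (aeval (algebraMap K⟦X⟧ K⸨X⸩ u) f) = (WithZero.exp (-d) : ℤᵐ⁰) := by
    rw [← hη, map_pow, valued_powerSeries_X, ← WithZero.exp_nsmul]
    simp
  obtain ⟨P, -, h2, h3, -⟩ := hf.exists_point_of_laurent hη
    (ne_algebraMap_of_valued (by simpa using hd) hξ) (a := 0) (i := 0) (j := 1)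
    (by rw [zpow_one, zpow_zero, one_mul, valued_powerSeries_X])
  refine ⟨P, ?_, by rw [h2, valued_powerSeries_X]⟩
  rw [h3]
  have : algebraMap K⟦X⟧ K⸨X⸩ u - algebraMap K _ a =
      algebraMap K⟦X⟧ K⸨X⸩ (u - PowerSeries.C a) := (map_sub _ _ _).symm
  rw [this]
  exact valued_powerSeries_lt_one (by simp [hub])

/-- There is a point at infinity, parametrized by `x = t ^ (-d)` and `y = t ^ (-n) u(t)`. -/
theorem exists_point_infinity (hf : IsSuperelliptic f n d) :
    ∃ P : Point f d, P.val (xFun f d) = WithZero.exp (d : ℤ) ∧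
      P.val (yFun f d) = WithZero.exp (n : ℤ) := by
  have hd := hf.d_ne_zero
  have hlc : f.leadingCoeff ≠ 0 := leadingCoeff_ne_zero.2 hf.ne_zero
  obtain ⟨c, hc⟩ := IsAlgClosed.exists_pow_nat_eq f.leadingCoeff (Nat.pos_of_ne_zero hd)
  have hc0 : c ≠ 0 := by rintro rfl; rw [zero_pow hd] at hc; exact hlc hc.symm
  have hcc : PowerSeries.constantCoeff (aeval (PowerSeries.X ^ d : K⟦X⟧) f.reverse) =
      f.leadingCoeff := by
    rw [aeval_def, hom_eval₂, map_pow, PowerSeries.constantCoeff_X, zero_pow hd,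
      eval₂_at_zero, coeff_zero_reverse]
    exact PowerSeries.constantCoeff_C _
  -- `y = t ^ (-n) * u` solves `y ^ d = f(t ^ (-d))` when `u ^ d` is the reverse of `f` at `t ^ d`
  obtain ⟨u, hu, hub⟩ := exists_powerSeries_root (K := K) (c := c)
    (monic_X_pow_sub_C (aeval (PowerSeries.X ^ d : K⟦X⟧) f.reverse) hd) (by simp [hcc, hc])
    (by simpa [derivative_X_pow, hf.cast_ne_zero] using pow_ne_zero _ hc0)
  have hud : u ^ d = aeval (PowerSeries.X ^ d : K⟦X⟧) f.reverse := by
    simpa [sub_eq_zero] using hu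
  let T : K⸨X⸩ := algebraMap K⟦X⟧ K⸨X⸩ PowerSeries.X
  have hT : Valued.v T = (WithZero.exp (-1) : ℤᵐ⁰) := valued_powerSeries_X
  have hT0 : T ≠ 0 := by
    intro h
    rw [h, map_zero] at hT
    exact WithZero.exp_ne_zero hT.symm
  have hTk : ∀ k : ℕ, Valued.v ((T ^ k)⁻¹) = (WithZero.exp (k : ℤ) : ℤᵐ⁰) := fun k => by
    rw [map_inv₀, map_pow, hT, ← WithZero.exp_nsmul, ← WithZero.exp_neg]
    simp
  have hx := hTk d
  have hy : Valued.v ((T ^ n)⁻¹ * algebraMap K⟦X⟧ K⸨X⸩ u) = (WithZero.exp (n : ℤ) : ℤᵐ⁰) := by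
    rw [map_mul, hTk, valued_powerSeries_eq_one (by rwa [hub]), mul_one]
  have hη : ((T ^ n)⁻¹ * algebraMap K⟦X⟧ K⸨X⸩ u) ^ d = aeval (T ^ d)⁻¹ f := by
    let _ : Invertible (T ^ d)⁻¹ := invertibleOfNonzero (inv_ne_zero (pow_ne_zero _ hT0))
    rw [mul_pow, ← map_pow _ u, hud, ← aeval_algebraMap_powerSeries, aeval_def, aeval_def,
      ← eval₂_reverse_mul_pow _ (T ^ d)⁻¹ f, hf.natDegree_eq, invOf_eq_inv, inv_inv, map_pow,
      mul_comm, inv_pow, inv_pow, ← pow_mul, ← pow_mul, mul_comm n d]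
  have hξ : Valued.v (aeval ((T ^ d)⁻¹) (X : K[X])) = (WithZero.exp (d : ℤ) : ℤᵐ⁰) := by
    rw [aeval_X, hx]
  -- Bézout coefficients of `n` and `d` make a monomial in `x` and `y` a uniformizer
  have hbez := Nat.gcd_eq_gcd_ab n d
  rw [Nat.Coprime.gcd_eq_one hf.coprime] at hbez
  obtain ⟨P, h1, h2, -, -⟩ := hf.exists_point_of_laurent hη
    (ne_algebraMap_of_valued (by exact_mod_cast hd) hξ) (a := 0) (i := -Nat.gcdB n d)
    (j := -Nat.gcdA n d) (by
      rw [map_zero, sub_zero, map_mul, map_zpow₀, map_zpow₀, hx, hy, ← WithZero.exp_zsmul,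
        ← WithZero.exp_zsmul, ← WithZero.exp_add]
      congr 1
      push_cast at hbez
      simp only [smul_eq_mul]
      linarith)
  exact ⟨P, by rw [h1, hx], by rw [h2, hy]⟩

end IsSuperelliptic

end

/-! ### Uniqueness of points -/

section Uniqueness

variable {f : K[X]} {d : ℕ}

theorem Point.val_const_le_one (P : Point f d) (c : K) : P.val (algebraMap K _ c) ≤ 1 :=
  val_algebraMap_le_one P.val_const c

/-- Normalization forces two points whose valuations are proportional on the coordinate ring to be
equal. -/
theorem Point.eq_of_val_eq_pow {P Q : Point f d} {k : ℕ}
    (h : ∀ A : CoordRing f d, P.val (algebraMap _ _ A) = Q.val (algebraMap _ _ A) ^ k) :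
    P = Q := by
  have key : ∀ z, P.val z = Q.val z ^ k := by
    intro z
    obtain ⟨⟨A, B⟩, hAB⟩ := IsLocalization.surj (nonZeroDivisors (CoordRing f d)) z
    have hB : Q.val (algebraMap _ (FunField f d) (B : CoordRing f d)) ≠ 0 :=
      ((IsLocalization.map_units (FunField f d) B).map Q.val).ne_zero
    have h1 := congrArg P.val hAB
    have h2 := congrArg Q.val hAB
    rw [map_mul] at h1 h2
    rw [h, h, ← h2, mul_pow] at h1
    exact mul_right_cancel₀ (pow_ne_zero k hB) h1
  obtain ⟨z, hz⟩ := P.surjective_val (WithZero.exp 1)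
  have hk : k = 1 := by
    have h1 := congrArg WithZero.log ((key z).symm.trans hz)
    rw [WithZero.log_pow, WithZero.log_exp, nsmul_eq_mul] at h1
    have := Int.isUnit_iff.1 (IsUnit.of_mul_eq_one _ h1)
    omega
  ext z
  rw [key, hk, pow_one]

theorem val_yFun_lt_one {P : Point f d} (hd : d ≠ 0) {a : K} (ha : f.eval a = 0)
    (h : P.val (xFun f d - algebraMap K _ a) < 1) : P.val (yFun f d) < 1 := by
  have := val_aeval_lt_one P.val_const h ha
  rwa [← yFun_pow, map_pow, pow_lt_one_iff hd] at this

theorem val_coordRing_le_one {P : Point f d} (hd : d ≠ 0) (hP : P.val (xFun f d) ≤ 1)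
    (A : CoordRing f d) : P.val (algebraMap _ _ A) ≤ 1 := by
  have hy : P.val (yFun f d) ≤ 1 := by
    rw [← pow_le_one_iff hd, ← map_pow, yFun_pow]
    exact val_aeval_le_one P.val_const hP f
  obtain ⟨p, rfl⟩ := AdjoinRoot.mk_surjective A
  rw [algebraMap_mk]
  refine P.val.map_sum_le fun i _ => ?_
  rw [map_mul, map_pow]
  exact mul_le_one' (val_aeval_le_one P.val_const hP _) (pow_le_one' hy _)

theorem algebraMap_aeval_root (q : K[X]) :
    algebraMap (CoordRing f d) (FunField f d) (aeval (AdjoinRoot.root _) q) =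
      aeval (yFun f d) q := by
  rw [yFun, aeval_algebraMap_apply]

/-- The pole order at infinity of the function `∑ pᵢ(x) yⁱ`, where `x` has a pole of order `d` and
`y` has a pole of order `n`. -/
def poleOrder (n d : ℕ) (p : K[X][X]) : ℕ :=
  p.support.sup fun i => d * (p.coeff i).natDegree + n * i

theorem le_poleOrder (n d : ℕ) {p : K[X][X]} {i : ℕ} (hi : p.coeff i ≠ 0) :
    d * (p.coeff i).natDegree + n * i ≤ poleOrder n d p :=
  Finset.le_sup (f := fun i => d * (p.coeff i).natDegree + n * i) (mem_support_iff.2 hi)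

end Uniqueness

namespace IsSuperelliptic

variable {f : K[X]} {n d : ℕ}

/-- Since `n` and `d` are coprime, the terms `pᵢ(x) yⁱ` with `i < d` have distinct pole orders at
infinity, so a pole of `x` has a valuation that is determined up to a factor. -/
theorem exists_val_of_one_lt (hf : IsSuperelliptic f n d) {P : Point f d}
    (hP : 1 < P.val (xFun f d)) :
    ∃ k : ℕ, P.val (xFun f d) = WithZero.exp (1 : ℤ) ^ (d * k) ∧
      P.val (yFun f d) = WithZero.exp (1 : ℤ) ^ (n * k) ∧
      ∀ p : K[X][X], p ≠ 0 → p.natDegree < d →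
        P.val (algebraMap (CoordRing f d) _ (AdjoinRoot.mk _ p)) =
          WithZero.exp (1 : ℤ) ^ (k * poleOrder n d p) := by
  classical
  have hd := hf.d_ne_zero
  have h1 := congrArg P.val (yFun_pow f d)
  rw [val_aeval_of_one_lt P.val_const hP hf.ne_zero, hf.natDegree_eq, map_pow] at h1
  have hx0 : P.val (xFun f d) ≠ 0 := (zero_lt_one.trans hP).ne'
  have hy0 : P.val (yFun f d) ≠ 0 := by
    intro h; rw [h, zero_pow hd] at h1; exact pow_ne_zero _ hx0 h1.symm
  have h2 := congrArg WithZero.log h1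
  rw [WithZero.log_pow, WithZero.log_pow, nsmul_eq_mul, nsmul_eq_mul] at h2
  have hxpos : 0 < WithZero.log (P.val (xFun f d)) := by
    rwa [← WithZero.exp_lt_exp, WithZero.exp_log hx0, WithZero.exp_zero]
  obtain ⟨a, ha⟩ := Int.eq_ofNat_of_zero_le hxpos.le
  have hdvd : (d : ℤ) ∣ a := by
    refine (Nat.isCoprime_iff_coprime.2 hf.coprime.symm).dvd_of_dvd_mul_left ?_
    rw [← ha, ← h2]; exact dvd_mul_right _ _
  obtain ⟨k, rfl⟩ := Int.natCast_dvd_natCast.1 hdvd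
  have hexp : ∀ m : ℕ, (WithZero.exp (1 : ℤ)) ^ m = WithZero.exp (m : ℤ) := fun m => by
    rw [← WithZero.exp_nsmul]; simp
  have hx : P.val (xFun f d) = WithZero.exp (1 : ℤ) ^ (d * k) := by
    rw [hexp, ← ha, WithZero.exp_log hx0]
  have hk : k ≠ 0 := by rintro rfl; simp [ha] at hxpos
  have hy : P.val (yFun f d) = WithZero.exp (1 : ℤ) ^ (n * k) := by
    rw [hexp, ← WithZero.exp_log hy0]
    congr 1
    rw [ha] at h2
    have hd' : (d : ℤ) ≠ 0 := by exact_mod_cast hd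
    apply mul_left_cancel₀ hd'
    rw [h2]; push_cast; ring
  refine ⟨k, hx, hy, fun p hp hpd => ?_⟩
  have hterm : ∀ i ∈ p.support, P.val (aeval (xFun f d) (p.coeff i) * yFun f d ^ i) =
      WithZero.exp (1 : ℤ) ^ (k * (d * (p.coeff i).natDegree + n * i)) := by
    intro i hi
    rw [map_mul, map_pow, val_aeval_of_one_lt P.val_const hP (mem_support_iff.1 hi), hx, hy,
      ← pow_mul, ← pow_mul, ← pow_add]
    congr 1; ring
  obtain ⟨j, hj, hjs⟩ := Finset.exists_mem_eq_sup p.support (support_nonempty.2 hp)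
    (fun i => d * (p.coeff i).natDegree + n * i)
  rw [algebraMap_mk, P.val.map_sum_eq_of_lt hj, hterm j hj, poleOrder, hjs]
  intro i hi
  rw [Finset.mem_sdiff, Finset.mem_singleton] at hi
  rw [hterm j hj, hterm i hi.1]
  refine pow_lt_pow_right₀ ?_ ?_
  · rw [← WithZero.exp_zero, WithZero.exp_lt_exp]; norm_num
  refine Nat.mul_lt_mul_of_pos_left (lt_of_le_of_ne ?_ ?_) (Nat.pos_of_ne_zero hk)
  · rw [← hjs]; exact le_poleOrder n d (mem_support_iff.1 hi.1)
  intro heq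
  apply hi.2
  have hi' : i < d := (le_natDegree_of_mem_supp i hi.1).trans_lt hpd
  have hj' : j < d := (le_natDegree_of_mem_supp j hj).trans_lt hpd
  have hmod : n * i ≡ n * j [MOD d] := by
    have := congrArg (· % d) heq
    simpa [Nat.ModEq, Nat.add_mod] using this
  have := Nat.ModEq.cancel_left_of_coprime (hf.coprime.symm) hmod
  rwa [Nat.ModEq, Nat.mod_eq_of_lt hi', Nat.mod_eq_of_lt hj'] at this

/-- Away from the ramification points, `x - a` generates the maximal ideal of the local ring, so the
order of vanishing of a function does not depend on the valuation centred at the point. -/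
theorem val_eq_pow_of_val_eq (hf : IsSuperelliptic f n d) {a b : K} (hb : b ≠ 0)
    (hab : b ^ d = f.eval a) {P Q : Point f d}
    (hP : P.val (xFun f d - algebraMap K _ a) = WithZero.exp (-1))
    (hP' : P.val (yFun f d - algebraMap K _ b) < 1)
    (hQ : Q.val (xFun f d - algebraMap K _ a) < 1)
    (hQ' : Q.val (yFun f d - algebraMap K _ b) < 1) (k : ℕ) :
    ∀ A : CoordRing f d, P.val (algebraMap _ _ A) = WithZero.exp (-1) ^ k →
      Q.val (algebraMap _ _ A) = Q.val (xFun f d - algebraMap K _ a) ^ k := by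
  have hF : ∀ (B : CoordRing f d) (q : K[X]), algebraMap (CoordRing f d) (FunField f d)
      (AdjoinRoot.of _ (X - C a) * B + aeval (AdjoinRoot.root _) q) =
      (xFun f d - algebraMap K _ a) * algebraMap _ _ B + aeval (yFun f d) q := fun B q => by
    rw [map_add, map_mul, algebraMap_aeval_root, algebraMap_of_eq_aeval]; simp
  have hlt : ∀ (R : Point f d), R.val (xFun f d - algebraMap K _ a) < 1 → ∀ B : CoordRing f d,
      R.val ((xFun f d - algebraMap K _ a) * algebraMap _ _ B) < 1 := fun R hR B => by
    rw [map_mul]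
    exact (mul_le_of_le_one_right' (val_coordRing_le_one hf.d_ne_zero
      (val_le_one_of_val_sub_lt_one R.val_const hR) B)).trans_lt hR
  have hPx : P.val (xFun f d - algebraMap K _ a) < 1 := by
    rw [hP, ← WithZero.exp_zero, WithZero.exp_lt_exp]; norm_num
  induction k with
  | zero =>
    intro A hA
    obtain ⟨q, B, -, rfl⟩ := exists_eq_mul_add_aeval hf.d_ne_zero A a
    rw [hF, pow_zero] at hA ⊢
    have hq : q.eval b ≠ 0 := fun hq =>
      (P.val.map_add_lt (hlt P hPx B) (val_aeval_lt_one P.val_const hP' hq)).ne hA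
    have h1 := val_aeval_eq_one Q.val_const hQ' hq
    rw [Q.val.map_add_eq_of_lt_right (by rw [h1]; exact hlt Q hQ B), h1]
  | succ k ih =>
    intro A hA
    obtain ⟨q, B, -, rfl⟩ := exists_eq_mul_add_aeval hf.d_ne_zero A a
    have hA1 : P.val (algebraMap _ (FunField f d)
        (AdjoinRoot.of _ (X - C a) * B + aeval (AdjoinRoot.root _) q)) < 1 := by
      rw [hA, pow_lt_one_iff (Nat.succ_ne_zero k), ← WithZero.exp_zero, WithZero.exp_lt_exp]
      norm_num
    have hq : q.eval b = 0 := by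
      by_contra hq
      have h1 := val_aeval_eq_one P.val_const hP' hq
      rw [hF, P.val.map_add_eq_of_lt_right (by rw [h1]; exact hlt P hPx B), h1] at hA1
      exact lt_irrefl _ hA1
    obtain ⟨r, rfl⟩ := dvd_iff_isRoot.2 hq
    -- `(y - b) u(y) = y ^ d - b ^ d = (x - a) g(x)`, and `u(y)` is a unit at the point
    obtain ⟨u, hu⟩ : X - C b ∣ X ^ d - C (b ^ d) := by
      simpa using X_sub_C_dvd_sub_C_eval (a := b) (p := (X ^ d : K[X]))
    obtain ⟨g, hg⟩ := X_sub_C_dvd_sub_C_eval (a := a) (p := f)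
    have hub : u.eval b ≠ 0 := by
      have h1 := congrArg (fun p => (derivative p).eval b) hu
      simp only [derivative_sub, derivative_X_pow, derivative_C, derivative_mul, derivative_X,
        eval_sub, eval_add, eval_mul, eval_pow, eval_X, eval_C, sub_zero, sub_self, one_mul,
        zero_mul, add_zero] at h1
      rw [← h1]
      exact mul_ne_zero hf.cast_ne_zero (pow_ne_zero _ hb)
    have hyx : (yFun f d - algebraMap K _ b) * aeval (yFun f d) u =
        (xFun f d - algebraMap K _ a) * aeval (xFun f d) g := by
      have h1 := congrArg (aeval (yFun f d)) hu
      have h2 := congrArg (aeval (xFun f d)) hg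
      simp only [map_sub, map_mul, aeval_X, aeval_C, map_pow] at h1 h2
      rw [← h1, ← h2, yFun_pow, ← hab, map_pow]
    set A' : CoordRing f d := B * aeval (AdjoinRoot.root _) u +
      AdjoinRoot.of _ g * aeval (AdjoinRoot.root _) r with hA'
    have hmul : aeval (yFun f d) u * algebraMap _ (FunField f d)
        (AdjoinRoot.of _ (X - C a) * B + aeval (AdjoinRoot.root _) ((X - C b) * r)) =
        (xFun f d - algebraMap K _ a) * algebraMap _ _ A' := by
      rw [hF, hA']
      simp only [map_add, map_mul, algebraMap_aeval_root, algebraMap_of_eq_aeval, map_sub,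
        aeval_X, aeval_C]
      linear_combination aeval (yFun f d) r * hyx
    have h1 := congrArg P.val hmul
    have h2 := congrArg Q.val hmul
    rw [P.val.map_mul, P.val.map_mul, val_aeval_eq_one P.val_const hP' hub, one_mul, hA, hP, pow_succ',
      mul_right_inj' WithZero.exp_ne_zero] at h1
    rw [Q.val.map_mul, Q.val.map_mul, val_aeval_eq_one Q.val_const hQ' hub, one_mul, ih A' h1.symm,
      ← pow_succ'] at h2
    exact h2

variable [IsAlgClosed K]

/-- The point at infinity exists and is unique, and the valuation there of a reduced expression
`∑ pᵢ(x) yⁱ` is given by its pole order. -/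
theorem exists_isInfinity (hf : IsSuperelliptic f n d) :
    ∃ O : Point f d, O.IsInfinity ∧ O.val (xFun f d) = WithZero.exp (d : ℤ) ∧
      O.val (yFun f d) = WithZero.exp (n : ℤ) ∧
      ∀ p : K[X][X], p ≠ 0 → p.natDegree < d →
        O.val (algebraMap (CoordRing f d) _ (AdjoinRoot.mk _ p)) =
          WithZero.exp (poleOrder n d p : ℤ) := by
  have hd := hf.d_ne_zero
  have hexp : ∀ m : ℕ, (WithZero.exp (1 : ℤ)) ^ m = WithZero.exp (m : ℤ) := fun m => by
    rw [← WithZero.exp_nsmul]; simp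
  obtain ⟨O, hx, hy⟩ := hf.exists_point_infinity
  have hO : 1 < O.val (xFun f d) := by
    rw [hx, ← WithZero.exp_zero, WithZero.exp_lt_exp]
    exact_mod_cast Nat.pos_of_ne_zero hd
  obtain ⟨k, hk, -, hmk⟩ := hf.exists_val_of_one_lt hO
  obtain rfl : k = 1 := by
    rw [hx, hexp, WithZero.exp_inj] at hk
    have : d * 1 = d * k := by rw [mul_one]; exact_mod_cast hk
    exact (Nat.eq_of_mul_eq_mul_left (Nat.pos_of_ne_zero hd) this).symm
  refine ⟨O, fun P => ⟨fun hP => ?_, fun h => h ▸ hO⟩, hx, hy, fun p hp hpd => ?_⟩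
  · obtain ⟨l, -, -, hl⟩ := hf.exists_val_of_one_lt hP
    refine Point.eq_of_val_eq_pow (k := l) fun A => ?_
    obtain ⟨p, hp, rfl⟩ := exists_mk_eq hd A
    by_cases hp0 : p = 0
    · have hl0 : l ≠ 0 := by
        rintro rfl
        have h1 := hl (C X) (by simp) (by simpa using Nat.pos_of_ne_zero hd)
        rw [AdjoinRoot.mk_C, zero_mul, pow_zero] at h1
        exact hP.ne' h1
      simp [hp0, hl0]
    · rw [hl p hp0 hp, hmk p hp0 hp, ← pow_mul, one_mul, mul_comm]
  · rw [hmk p hp hpd, one_mul, hexp]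

/-- For `b ≠ 0` there is exactly one point over `(a, b)`. -/
theorem exists_isAffine (hf : IsSuperelliptic f n d) {a b : K} (hb : b ≠ 0)
    (hab : b ^ d = f.eval a) :
    ∃ P : Point f d, P.IsAffine a b ∧ P.val (xFun f d - algebraMap K _ a) = WithZero.exp (-1) ∧
      P.val (yFun f d - algebraMap K _ b) < 1 := by
  have := hf.isDomain
  have hexp : ∀ m : ℕ, (WithZero.exp (-1 : ℤ)) ^ m = WithZero.exp (-m : ℤ) := fun m => by
    rw [← WithZero.exp_nsmul]; simp
  obtain ⟨P, hP, hP'⟩ := hf.exists_point_unramified hb hab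
  have hPx : P.val (xFun f d - algebraMap K _ a) < 1 := by
    rw [hP, ← WithZero.exp_zero, WithZero.exp_lt_exp]; norm_num
  have hle : ∀ γ : ℤᵐ⁰, γ ≠ 0 → γ ≤ 1 → ∃ m : ℕ, γ = WithZero.exp (-1) ^ m := by
    intro γ h0 h1
    rw [← WithZero.exp_log h0, ← WithZero.exp_zero, WithZero.exp_le_exp] at h1
    obtain ⟨m, hm⟩ := Int.eq_ofNat_of_zero_le (neg_nonneg.2 h1)
    exact ⟨m, by rw [hexp, ← hm, neg_neg, WithZero.exp_log h0]⟩
  refine ⟨P, fun Q => ⟨fun ⟨hQ, hQ'⟩ => ?_, fun h => h ▸ ⟨hPx, hP'⟩⟩, hP, hP'⟩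
  have hx0 : xFun f d - algebraMap K _ a ≠ 0 := by
    rw [← P.val.ne_zero_iff, hP]; exact WithZero.exp_ne_zero
  obtain ⟨k, hk⟩ := hle _ (Q.val.ne_zero_iff.2 hx0) hQ.le
  refine Point.eq_of_val_eq_pow (k := k) fun A => ?_
  by_cases hA : algebraMap (CoordRing f d) (FunField f d) A = 0
  · have hk0 : k ≠ 0 := by
      rintro rfl
      rw [pow_zero] at hk
      exact hQ.ne hk
    rw [hA, map_zero, map_zero, zero_pow hk0]
  · obtain ⟨m, hm⟩ := hle _ (P.val.ne_zero_iff.2 hA)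
      (val_coordRing_le_one hf.d_ne_zero (val_le_one_of_val_sub_lt_one P.val_const hPx) A)
    rw [hf.val_eq_pow_of_val_eq hb hab hP hP' hQ hQ' m A hm, hm, hk, pow_right_comm]

end IsSuperelliptic

/-! ### Functions without poles at finite distance -/

namespace IsSuperelliptic

variable {f : K[X]} {n d : ℕ}

/-- Total ramification over a root `a` of `f`. -/
theorem val_xFun_sub_eq_val_yFun_pow (hf : IsSuperelliptic f n d) {P : Point f d} {a : K}
    (ha : f.eval a = 0) (hP : P.val (xFun f d - algebraMap K _ a) < 1) :
    P.val (xFun f d - algebraMap K _ a) = P.val (yFun f d) ^ d := by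
  obtain ⟨g, hfg⟩ := dvd_iff_isRoot.2 ha
  have hg : g.eval a ≠ 0 := by
    have := hf.derivative_eval_ne_zero ha
    simpa [hfg, derivative_mul] using this
  have h := congrArg (fun q => P.val (aeval (xFun f d) q)) hfg
  simp only [map_mul, val_aeval_eq_one P.val_const hP hg, mul_one, map_sub, aeval_X, aeval_C] at h
  rw [← map_pow, yFun_pow, h]

variable [IsAlgClosed K]

theorem exists_finset_roots (hf : IsSuperelliptic f n d) {c : K} (hc : c ≠ 0) :
    ∃ s : Finset K, s.card = d ∧ ∀ b ∈ s, b ^ d = c := by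
  classical
  have hsep := separable_X_pow_sub_C c hf.cast_ne_zero hc
  refine ⟨(X ^ d - C c).roots.toFinset, ?_, fun b hb => ?_⟩
  · rw [Multiset.toFinset_card_of_nodup (Polynomial.nodup_roots hsep),
      ← (IsAlgClosed.splits (X ^ d - C c)).natDegree_eq_card_roots, natDegree_X_pow_sub_C]
  · rw [Multiset.mem_toFinset] at hb
    simpa [sub_eq_zero] using isRoot_of_mem_roots hb

theorem exists_point (hf : IsSuperelliptic f n d) {a b : K} (hab : b ^ d = f.eval a) :
    ∃ P : Point f d, P.val (xFun f d - algebraMap K _ a) < 1 ∧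
      P.val (yFun f d - algebraMap K _ b) < 1 := by
  have hlt : (WithZero.exp (-1 : ℤ)) < 1 := by
    rw [← WithZero.exp_zero, WithZero.exp_lt_exp]; norm_num
  by_cases hb : b = 0
  · subst hb
    rw [zero_pow hf.d_ne_zero] at hab
    obtain ⟨P, h1, h2⟩ := hf.exists_point_ramified hab.symm
    exact ⟨P, h1, by rw [map_zero, sub_zero, h2]; exact hlt⟩
  · obtain ⟨P, h1, h2⟩ := hf.exists_point_unramified hb hab
    exact ⟨P, by rw [h1]; exact hlt, h2⟩

/-- A polynomial in `y` of degree less than `d` that vanishes on the fibre over `a` as much as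
`x - a` does is zero. -/
theorem eq_zero_of_val_aeval_yFun_le (hf : IsSuperelliptic f n d) {a : K} {q : K[X]}
    (hqd : q.natDegree < d)
    (hq : ∀ P : Point f d, P.val (xFun f d - algebraMap K _ a) < 1 →
      P.val (aeval (yFun f d) q) ≤ P.val (xFun f d - algebraMap K _ a)) : q = 0 := by
  classical
  by_cases ha : f.eval a = 0
  · by_contra hq0
    obtain ⟨P, hP, hy⟩ := hf.exists_point_ramified ha
    have h1 := hq P hP
    rw [hf.val_xFun_sub_eq_val_yFun_pow ha hP] at h1
    have hy1 : P.val (yFun f d - algebraMap K _ 0) < 1 := by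
      rw [map_zero, sub_zero]; exact val_yFun_lt_one hf.d_ne_zero ha hP
    obtain ⟨r, hr, hrX⟩ := exists_eq_pow_rootMultiplicity_mul_and_not_dvd q hq0 0
    have hr0 : r.eval 0 ≠ 0 := fun h => hrX (dvd_iff_isRoot.2 h)
    have hm : rootMultiplicity 0 q ≤ q.natDegree := by
      rw [← count_roots]
      exact (Multiset.count_le_card _ _).trans (card_roots' q)
    generalize rootMultiplicity 0 q = m at hr hm
    rw [hr, map_mul, map_mul, val_aeval_eq_one P.val_const hy1 hr0, mul_one, C_0, sub_zero,
      map_pow, aeval_X, map_pow] at h1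
    have h2 := pow_lt_pow_right_of_lt_one₀ (a := P.val (yFun f d))
      (by rw [hy]; exact zero_lt_iff.2 WithZero.exp_ne_zero)
      (val_yFun_lt_one hf.d_ne_zero ha hP) (hm.trans_lt hqd)
    exact absurd h1 (not_le.2 h2)
  · obtain ⟨s, hs, hsb⟩ := hf.exists_finset_roots ha
    refine eq_zero_of_natDegree_lt_card_of_eval_eq_zero' q s (fun b hb => ?_) (by rwa [hs])
    by_contra hqb
    obtain ⟨P, h1, h2⟩ := hf.exists_point (hsb b hb)
    have h3 := hq P h1
    rw [val_aeval_eq_one P.val_const h2 hqb] at h3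
    exact absurd h3 (not_le.2 h1)

/-- Denominators in `K[x]` of a function without finite poles can be removed one linear factor at a
time. -/
theorem exists_algebraMap_eq_of_mul_eq (hf : IsSuperelliptic f n d) {s : K[X]} (hs : s ≠ 0)
    {h : FunField f d} (hreg : ∀ P : Point f d, P.val (xFun f d) ≤ 1 → P.val h ≤ 1)
    (hA : ∃ A : CoordRing f d, aeval (xFun f d) s * h = algebraMap _ _ A) :
    ∃ B : CoordRing f d, algebraMap _ _ B = h := by
  have := hf.isDomain
  induction hk : s.natDegree generalizing s h with
  | zero =>
    obtain ⟨A, hA⟩ := hA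
    rw [eq_C_of_natDegree_eq_zero hk, aeval_C] at hA
    have h0 : s.coeff 0 ≠ 0 := by
      intro h0; apply hs; rw [eq_C_of_natDegree_eq_zero hk, h0, C_0]
    refine ⟨AdjoinRoot.of _ (C (s.coeff 0)⁻¹) * A, ?_⟩
    rw [map_mul, ← hA, ← algebraMap_eq_coordRing, ← mul_assoc, ← map_mul, inv_mul_cancel₀ h0,
      map_one, one_mul]
  | succ k ih =>
    obtain ⟨a, ha⟩ := IsAlgClosed.exists_root s (by
      rw [degree_eq_natDegree hs, hk]; exact_mod_cast Nat.succ_ne_zero k)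
    obtain ⟨t, rfl⟩ := dvd_iff_isRoot.2 ha
    have ht : t ≠ 0 := right_ne_zero_of_mul hs
    rw [natDegree_mul (X_sub_C_ne_zero a) ht, natDegree_X_sub_C] at hk
    obtain ⟨A, hA⟩ := hA
    obtain ⟨q, B, hqd, rfl⟩ := exists_eq_mul_add_aeval hf.d_ne_zero A a
    refine ih ht hreg ⟨B, ?_⟩ (by omega)
    have hx0 : xFun f d - algebraMap K _ a ≠ 0 := by
      intro h0
      obtain ⟨O, -, hOx, -⟩ := hf.exists_isInfinity
      have h1 := O.val_const_le_one a
      rw [← sub_eq_zero.1 h0, hOx, ← WithZero.exp_zero, WithZero.exp_le_exp] at h1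
      have := hf.two_le
      omega
    have hA' : (xFun f d - algebraMap K _ a) * (aeval (xFun f d) t * h - algebraMap _ _ B) =
        aeval (yFun f d) q := by
      rw [map_mul, map_add, map_mul, algebraMap_aeval_root, algebraMap_of_eq_aeval] at hA
      simp only [map_sub, aeval_X, aeval_C] at hA
      linear_combination hA
    have hq : q = 0 := by
      refine hf.eq_zero_of_val_aeval_yFun_le hqd (a := a) fun P hP => ?_
      have hx := val_le_one_of_val_sub_lt_one P.val_const hP
      rw [← hA', map_mul]
      refine mul_le_of_le_one_right' (P.val.map_sub_le ?_ (val_coordRing_le_one hf.d_ne_zero hx B))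
      rw [map_mul]
      exact mul_le_one' (val_aeval_le_one P.val_const hx t) (hreg P hx)
    rw [hq, map_zero] at hA'
    exact sub_eq_zero.1 ((mul_eq_zero.1 hA').resolve_left hx0)

/-- A function without poles at finite distance lies in the coordinate ring. -/
theorem exists_algebraMap_eq (hf : IsSuperelliptic f n d) {h : FunField f d}
    (hreg : ∀ P : Point f d, P.val (xFun f d) ≤ 1 → P.val h ≤ 1) :
    ∃ B : CoordRing f d, algebraMap _ _ B = h := by
  have := hf.isDomain
  have : Module.Finite K[X] (CoordRing f d) :=
    (monic_equation (f := f) hf.d_ne_zero).finite_adjoinRoot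
  obtain ⟨⟨A, B⟩, hAB⟩ := IsLocalization.surj (nonZeroDivisors (CoordRing f d)) h
  have hne := Ideal.comap_ne_bot_of_integral_mem (R := K[X])
    (nonZeroDivisors.ne_zero B.2) (Ideal.mem_span_singleton_self (B : CoordRing f d))
    (Algebra.IsIntegral.isIntegral _)
  obtain ⟨s, hs, hs0⟩ := Submodule.exists_mem_ne_zero_of_ne_bot hne
  obtain ⟨D, hD⟩ := Ideal.mem_span_singleton.1 (Ideal.mem_comap.1 hs)
  refine hf.exists_algebraMap_eq_of_mul_eq hs0 hreg ⟨D * A, ?_⟩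
  have h1 : aeval (xFun f d) s = algebraMap _ _ ((B : CoordRing f d) * D) := by
    rw [← hD, ← algebraMap_of_eq_aeval]; rfl
  rw [h1, map_mul, map_mul, ← hAB]
  ring

end IsSuperelliptic

section Order

variable {f : K[X]} {d : ℕ}

/-- The divisor `k (P - O)` is principal iff it is the divisor of a function `h`; the values of `h` are
multiplicative, so a zero of order `k` reads `exp (-k)`. -/
theorem nsmul_jacClass_eq_zero_iff {O P : Point f d} (hPO : P ≠ O) (k : ℕ) :
    k • jacClass O P = 0 ↔ ∃ h : (FunField f d)ˣ, P.val (h : FunField f d) = WithZero.exp (-k : ℤ) ∧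
      O.val (h : FunField f d) = WithZero.exp (k : ℤ) ∧
      ∀ R : Point f d, R ≠ P → R ≠ O → R.val (h : FunField f d) = 1 := by
  classical
  have hord : ∀ (R : Point f d) (h : (FunField f d)ˣ) (m : ℤ),
      m = R.ord h ↔ R.val (h : FunField f d) = WithZero.exp (-m) := fun R h m => by
    rw [Point.ord, ← WithZero.exp_log (R.val_unit_ne_zero h), WithZero.exp_inj, WithZero.log_exp]
    omega
  rw [jacClass, ← QuotientAddGroup.mk_nsmul, QuotientAddGroup.eq_zero_iff,
    AddSubgroup.mem_addSubgroupOf]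
  constructor
  · rintro ⟨h, hh⟩
    refine ⟨h, ?_, ?_, fun R hRP hRO => ?_⟩
    · rw [← hord, ← hh]; simp [hPO.symm]
    · have := (hord O h (-k)).1 (by rw [← hh]; simp [hPO])
      simpa using this
    · rw [← WithZero.exp_zero, ← neg_zero, ← hord, ← hh]
      simp [hRP.symm, hRO.symm]
  · rintro ⟨h, h1, h2, h3⟩
    refine ⟨h, fun R => ?_⟩
    rw [hord]
    by_cases hRP : R = P
    · subst hRP; rw [h1]; simp [hPO.symm]
    by_cases hRO : R = O
    · subst hRO; rw [h2]; simp [hPO]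
    · rw [h3 R hRP hRO]; simp [Ne.symm hRP, Ne.symm hRO]

end Order

/-! ### Points of finite order -/

theorem jacClass_self {f : K[X]} {d : ℕ} (O : Point f d) : jacClass O O = 0 := by
  rw [jacClass, QuotientAddGroup.eq_zero_iff, AddSubgroup.mem_addSubgroupOf]
  simp

section

variable {f : K[X]} {d : ℕ}

theorem val_xFun_le_one_of_ne {O R : Point f d} (hO : O.IsInfinity) (h : R ≠ O) :
    R.val (xFun f d) ≤ 1 := by
  by_contra h'
  exact h ((hO R).1 (not_le.1 h'))

theorem ne_of_isInfinity {O R : Point f d} (hO : O.IsInfinity) {a : K}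
    (h : R.val (xFun f d - algebraMap K _ a) < 1) : R ≠ O := fun h' =>
  absurd (val_le_one_of_val_sub_lt_one R.val_const h) (not_le.2 ((hO R).2 h'))

end

namespace IsSuperelliptic

variable {f : K[X]} {n d : ℕ} [IsAlgClosed K]

theorem val_of_isInfinity (hf : IsSuperelliptic f n d) {O : Point f d} (hO : O.IsInfinity) :
    O.val (xFun f d) = WithZero.exp (d : ℤ) ∧ O.val (yFun f d) = WithZero.exp (n : ℤ) ∧
      ∀ p : K[X][X], p ≠ 0 → p.natDegree < d →
        O.val (algebraMap (CoordRing f d) _ (AdjoinRoot.mk _ p)) =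
          WithZero.exp (poleOrder n d p : ℤ) := by
  obtain ⟨O', -, h1, h2, h3⟩ := hf.exists_isInfinity
  obtain rfl : O' = O := by
    rw [← hO, h1, ← WithZero.exp_zero, WithZero.exp_lt_exp]
    exact_mod_cast Nat.pos_of_ne_zero hf.d_ne_zero
  exact ⟨h1, h2, h3⟩

/-- A relation `k (P - O) ∼ 0` is realized by a polynomial in `x` and `y` of pole order `k`. -/
theorem exists_poleOrder_eq (hf : IsSuperelliptic f n d) {O P : Point f d} (hO : O.IsInfinity)
    (hPO : P ≠ O) {k : ℕ} (hk : k • jacClass O P = 0) :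
    ∃ p : K[X][X], p.natDegree < d ∧ poleOrder n d p = k ∧ ∀ R : Point f d, R ≠ P → R ≠ O →
      R.val (algebraMap (CoordRing f d) _ (AdjoinRoot.mk _ p)) = 1 := by
  obtain ⟨h, h1, h2, h3⟩ := (nsmul_jacClass_eq_zero_iff hPO k).1 hk
  obtain ⟨hOx, -, hOp⟩ := hf.val_of_isInfinity hO
  obtain ⟨B, hB⟩ := hf.exists_algebraMap_eq (h := (h : FunField f d)) fun R hR => by
    by_cases hRP : R = P
    · rw [hRP, h1, ← WithZero.exp_zero, WithZero.exp_le_exp]; omega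
    · exact (h3 R hRP fun hRO => absurd hR (not_le.2 ((hO R).2 hRO))).le
  obtain ⟨p, hp, rfl⟩ := exists_mk_eq hf.d_ne_zero B
  have hp0 : p ≠ 0 := by
    rintro rfl
    rw [map_zero, map_zero] at hB
    exact O.val_unit_ne_zero h (by rw [← hB, map_zero])
  refine ⟨p, hp, ?_, fun R hRP hRO => by rw [hB]; exact h3 R hRP hRO⟩
  rw [← hB, hOp p hp0 hp, WithZero.exp_inj] at h2
  exact_mod_cast h2

/-- A nonconstant polynomial in `x` vanishes at every point of a fibre of `x`. If its only zero is
at `P`, that fibre consists of `P` alone, so `P` is a ramification point. -/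
theorem eval_eq_zero_of_val_aeval_xFun (hf : IsSuperelliptic f n d) {O P : Point f d}
    (hO : O.IsInfinity) {a b : K} (hP : P.IsAffine a b) {s : K[X]} (hs : s.natDegree ≠ 0)
    (hval : ∀ R : Point f d, R ≠ P → R ≠ O → R.val (aeval (xFun f d) s) = 1) :
    f.eval a = 0 := by
  obtain ⟨hPa, hPb⟩ := (hP P).2 rfl
  obtain ⟨α, hα⟩ := IsAlgClosed.exists_root s (fun h => hs (natDegree_eq_of_degree_eq_some h))
  have key : ∀ β : K, β ^ d = f.eval α → α = a ∧ β = b := by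
    intro β hβ
    obtain ⟨R, hRα, hRβ⟩ := hf.exists_point hβ
    have hRP : R = P := by
      by_contra hRP
      exact (val_aeval_lt_one R.val_const hRα hα).ne (hval R hRP (ne_of_isInfinity hO hRα))
    subst hRP
    exact ⟨eq_of_val_sub_lt_one R.val_const hRα hPa, eq_of_val_sub_lt_one R.val_const hRβ hPb⟩
  by_contra ha
  obtain ⟨β, hβ⟩ := IsAlgClosed.exists_pow_nat_eq (f.eval α) (Nat.pos_of_ne_zero hf.d_ne_zero)
  obtain ⟨rfl, -⟩ := key β hβ
  obtain ⟨S, hS, hSr⟩ := hf.exists_finset_roots ha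
  obtain ⟨β₁, h₁, β₂, h₂, hne⟩ := Finset.one_lt_card.1
    (show 1 < S.card by rw [hS]; have := hf.two_le; omega)
  exact hne ((key β₁ (hSr _ h₁)).2.trans (key β₂ (hSr _ h₂)).2.symm)

/-- At a ramification point `(a, 0)`, the function `x - a` has divisor `d (P - O)`. -/
theorem nsmul_jacClass_eq_zero_of_eval_eq_zero (hf : IsSuperelliptic f n d) {O P : Point f d}
    (hO : O.IsInfinity) {a b : K} (hP : P.IsAffine a b) (ha : f.eval a = 0) :
    d • jacClass O P = 0 := by
  have := hf.isDomain
  obtain ⟨hPa, hPb⟩ := (hP P).2 rfl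
  have hy0 : ∀ R : Point f d, R.val (xFun f d - algebraMap K _ a) < 1 →
      R.val (yFun f d - algebraMap K _ 0) < 1 := fun R hR => by
    rw [map_zero, sub_zero]; exact val_yFun_lt_one hf.d_ne_zero ha hR
  obtain rfl : b = 0 := eq_of_val_sub_lt_one P.val_const hPb (hy0 P hPa)
  obtain ⟨Q, hQ, hQy⟩ := hf.exists_point_ramified ha
  obtain rfl : Q = P := (hP Q).1 ⟨hQ, hy0 Q hQ⟩
  have hx0 : xFun f d - algebraMap K _ a ≠ 0 := by
    rw [← Q.val.ne_zero_iff, hf.val_xFun_sub_eq_val_yFun_pow ha hQ, hQy]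
    exact pow_ne_zero _ WithZero.exp_ne_zero
  rw [nsmul_jacClass_eq_zero_iff (ne_of_isInfinity hO hPa)]
  refine ⟨Units.mk0 _ hx0, ?_, ?_, fun R hRP hRO => ?_⟩
  · rw [Units.val_mk0, hf.val_xFun_sub_eq_val_yFun_pow ha hQ, hQy, ← WithZero.exp_nsmul]
    simp
  · have h := val_aeval_of_one_lt O.val_const ((hO O).2 rfl) (X_sub_C_ne_zero a)
    rw [natDegree_X_sub_C, pow_one, (hf.val_of_isInfinity hO).1, map_sub, aeval_X, aeval_C] at h
    exact h
  · rw [Units.val_mk0]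
    by_contra hne
    have hle : R.val (xFun f d - algebraMap K _ a) ≤ 1 :=
      R.val.map_sub_le (val_xFun_le_one_of_ne hO hRO) (R.val_const_le_one a)
    have hlt := lt_of_le_of_ne hle hne
    exact hRP ((hP R).1 ⟨hlt, hy0 R hlt⟩)

theorem addOrderOf_dvd_of_val_aeval_xFun (hf : IsSuperelliptic f n d) {O P : Point f d}
    (hO : O.IsInfinity) {a b : K} (hP : P.IsAffine a b) {s : K[X]} (hs : s.natDegree ≠ 0)
    (hval : ∀ R : Point f d, R ≠ P → R ≠ O → R.val (aeval (xFun f d) s) = 1) :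
    addOrderOf (jacClass O P) ∣ d :=
  addOrderOf_dvd_of_nsmul_eq_zero (hf.nsmul_jacClass_eq_zero_of_eval_eq_zero hO hP
    (hf.eval_eq_zero_of_val_aeval_xFun hO hP hs hval))

/-- If `n = (d - 1) ℓ`, a point of order `d ℓ` is the only zero of a function `y - v(x)` with `v` of
degree `ℓ`. -/
theorem exists_section (hf : IsSuperelliptic f n d) {ℓ : ℕ} (hn : n + ℓ = d * ℓ) (hℓd : ℓ < d)
    (hℓ : 2 ≤ ℓ) {O P : Point f d} (hO : O.IsInfinity) {a b : K} (hP : P.IsAffine a b)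
    (hord : addOrderOf (jacClass O P) = d * ℓ) :
    ∃ v : K[X], v.natDegree = ℓ ∧
      ∀ α : K, (v ^ d - f).eval α = 0 → α = a ∧ v.eval α = b := by
  obtain ⟨hPa, hPb⟩ := (hP P).2 rfl
  obtain ⟨p, hpd, hpk, hpR⟩ := hf.exists_poleOrder_eq hO (ne_of_isInfinity hO hPa)
    (hord ▸ addOrderOf_nsmul_eq_zero (jacClass O P))
  have hle : ∀ i, p.coeff i ≠ 0 → d * (p.coeff i).natDegree + n * i ≤ d * ℓ := fun i hi =>
    hpk ▸ le_poleOrder n d hi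
  -- `y ^ 2` has pole order `2 n = d ℓ + (d - 2) ℓ`, too large since `2 ≤ ℓ < d`
  have hp1 : p.natDegree ≤ 1 := by
    rw [natDegree_le_iff_coeff_eq_zero]
    intro i hi
    by_contra h
    have h1 := hle i h
    have h2 : n * 2 ≤ n * i := Nat.mul_le_mul_left n hi
    have h3 : 3 * ℓ ≤ d * ℓ := Nat.mul_le_mul_right ℓ (by omega)
    omega
  -- `x y` has pole order `d + n`, too large since `n + ℓ = d ℓ` and `ℓ < d`
  have hc : (p.coeff 1).natDegree = 0 := by
    by_cases h : p.coeff 1 = 0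
    · rw [h, natDegree_zero]
    have h1 := hle 1 h
    by_contra h2
    have h3 : d * 1 ≤ d * (p.coeff 1).natDegree := Nat.mul_le_mul_left d (by omega)
    omega
  obtain ⟨c, hc⟩ : ∃ c, p.coeff 1 = C c := ⟨_, eq_C_of_natDegree_eq_zero hc⟩
  obtain ⟨s, hs⟩ : ∃ s, p.coeff 0 = s := ⟨_, rfl⟩
  have hp : p = C (C c) * X + C s := by
    rw [← hc, ← hs]; exact eq_X_add_C_of_natDegree_le_one hp1
  have hmk : algebraMap (CoordRing f d) (FunField f d) (AdjoinRoot.mk _ p) =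
      algebraMap K _ c * yFun f d + aeval (xFun f d) s := by
    rw [hp, map_add, map_mul, map_add, map_mul, AdjoinRoot.mk_C, AdjoinRoot.mk_C, AdjoinRoot.mk_X,
      ← algebraMap_eq_coordRing, algebraMap_of_eq_aeval, yFun]
  have hsdeg : s.natDegree = ℓ := by
    have hp0 : p.support.Nonempty := by
      rw [support_nonempty]
      rintro rfl
      rw [poleOrder, support_zero, Finset.sup_empty] at hpk
      have : 0 < d * ℓ := Nat.mul_pos (by omega) (by omega)
      exact absurd hpk.symm this.ne'
    obtain ⟨j, hj, hjs⟩ := Finset.exists_mem_eq_sup p.support hp0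
      (fun i => d * (p.coeff i).natDegree + n * i)
    rw [← poleOrder, hpk] at hjs
    have hj1 := (le_natDegree_of_mem_supp j hj).trans hp1
    interval_cases j
    · rw [hs, mul_zero, add_zero] at hjs
      exact (Nat.eq_of_mul_eq_mul_left (by omega) hjs).symm
    · rw [hc, natDegree_C] at hjs
      omega
  -- otherwise the function is a polynomial in `x`, and the order of `P` divides `d`
  have hc0 : c ≠ 0 := by
    rintro rfl
    have := hf.addOrderOf_dvd_of_val_aeval_xFun hO hP (s := s) (by omega) fun R hRP hRO => by
      rw [← hpR R hRP hRO, hmk, map_zero, zero_mul, zero_add]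
    rw [hord] at this
    have h1 := Nat.le_of_dvd (by omega) this
    have h2 : d * 2 ≤ d * ℓ := Nat.mul_le_mul_left d hℓ
    omega
  refine ⟨C (-c⁻¹) * s, by rw [natDegree_C_mul (by simpa using hc0), hsdeg], fun α hα => ?_⟩
  set v := C (-c⁻¹) * s with hv
  rw [eval_sub, eval_pow, sub_eq_zero] at hα
  -- the function vanishes at the point `(α, v(α))` of the curve, which is therefore `P`
  obtain ⟨R, hRα, hRβ⟩ := hf.exists_point hα
  have hlt : R.val (algebraMap (CoordRing f d) (FunField f d) (AdjoinRoot.mk _ p)) < 1 := by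
    have : algebraMap (CoordRing f d) (FunField f d) (AdjoinRoot.mk _ p) = algebraMap K _ c *
        ((yFun f d - algebraMap K _ (v.eval α)) -
          (aeval (xFun f d) v - algebraMap K _ (v.eval α))) := by
      have hcc : algebraMap K (FunField f d) c * algebraMap K _ c⁻¹ = 1 := by
        rw [← map_mul, mul_inv_cancel₀ hc0, map_one]
      rw [hmk, sub_sub_sub_cancel_right, hv, map_mul, aeval_C, map_neg]
      linear_combination -aeval (xFun f d) s * hcc
    rw [this, map_mul, R.val_const c hc0, one_mul]
    exact R.val.map_sub_lt hRβ ((val_aeval_sub_le R.val_const hRα v).trans_lt hRα)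
  have hRP : R = P := by
    by_contra hRP
    exact hlt.ne (hpR R hRP (ne_of_isInfinity hO hRα))
  subst hRP
  exact ⟨eq_of_val_sub_lt_one R.val_const hRα hPa, eq_of_val_sub_lt_one R.val_const hRβ hPb⟩

end IsSuperelliptic

/-! ### Determination of the equation, and isomorphisms -/

theorem eq_leadingCoeff_mul_pow_of_roots_eq [IsAlgClosed K] {w : K[X]} {a : K}
    (h : ∀ α, w.eval α = 0 → α = a) : w = C w.leadingCoeff * (X - C a) ^ w.natDegree := by
  by_cases hw : w = 0
  · simp [hw]
  have hs := IsAlgClosed.splits w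
  have hr : w.roots = Multiset.replicate w.natDegree a :=
    Multiset.eq_replicate.2 ⟨hs.natDegree_eq_card_roots.symm, fun α hα =>
      h α (isRoot_of_mem_roots hα)⟩
  conv_lhs => rw [hs.eq_prod_roots, hr, Multiset.map_replicate, Multiset.prod_replicate]

/-- All terms of `∑ vⁱ u^(d-1-i)` have the same leading term, so the `d` leading coefficients add up
to a nonzero multiple of it. -/
theorem natDegree_geom_sum₂ {v u : K[X]} {ℓ d : ℕ} {e : K} (he : e ≠ 0) (hd : (d : K) ≠ 0)
    (hv : v.natDegree = ℓ) (hu : u.natDegree = ℓ) (hve : v.leadingCoeff = e)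
    (hue : u.leadingCoeff = e) :
    (∑ i ∈ Finset.range d, v ^ i * u ^ (d - 1 - i)).natDegree = (d - 1) * ℓ := by
  have hterm : ∀ i ∈ Finset.range d, (v ^ i * u ^ (d - 1 - i)).natDegree = (d - 1) * ℓ ∧
      (v ^ i * u ^ (d - 1 - i)).leadingCoeff = e ^ (d - 1) := by
    intro i hi
    have hv0 : v ≠ 0 := leadingCoeff_ne_zero.1 (hve ▸ he)
    have hu0 : u ≠ 0 := leadingCoeff_ne_zero.1 (hue ▸ he)
    have h1 : i + (d - 1 - i) = d - 1 := by have := Finset.mem_range.1 hi; omega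
    rw [natDegree_mul (pow_ne_zero _ hv0) (pow_ne_zero _ hu0), natDegree_pow, natDegree_pow, hv, hu,
      leadingCoeff_mul, leadingCoeff_pow, leadingCoeff_pow, hve, hue, ← pow_add, ← add_mul, h1]
    exact ⟨rfl, rfl⟩
  refine natDegree_eq_of_le_of_coeff_ne_zero
    (natDegree_sum_le_of_forall_le _ _ fun i hi => (hterm i hi).1.le) ?_
  rw [finsetSum_coeff, Finset.sum_congr rfl (g := fun _ => e ^ (d - 1)) fun i hi => by
    rw [← (hterm i hi).1, coeff_natDegree, (hterm i hi).2]]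
  rw [Finset.sum_const, Finset.card_range, nsmul_eq_mul]
  exact mul_ne_zero hd (pow_ne_zero _ he)

/-- The scaling factor `μ` is an `ℓ`-th root of `e / b`. -/
theorem exists_eq_comp [IsAlgClosed K] {f : K[X]} {d ℓ : ℕ} (hℓ : ℓ ≠ 0)
    {a b e : K} (he : e ≠ 0) (hb : b ≠ 0)
    (h : f = (C e * (X - C a) ^ ℓ + C b) ^ d - (C e * (X - C a) ^ ℓ) ^ d) :
    ∃ μ : K, μ ≠ 0 ∧
      f = C (b ^ d) * (-X ^ (d * ℓ) + (X ^ ℓ + 1) ^ d : K[X]).comp (C μ * (X - C a)) := by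
  obtain ⟨μ, hμ⟩ := IsAlgClosed.exists_pow_nat_eq (e / b) (Nat.pos_of_ne_zero hℓ)
  refine ⟨μ, ?_, ?_⟩
  · rintro rfl
    rw [zero_pow hℓ] at hμ
    exact div_ne_zero he hb hμ.symm
  have hbe : C e * (X - C a) ^ ℓ = C b * (C μ * (X - C a)) ^ ℓ := by
    rw [mul_pow, ← C_pow, hμ, ← mul_assoc, ← C_mul, mul_div_cancel₀ _ hb]
  rw [h, hbe]
  simp only [add_comp, neg_comp, pow_comp, X_comp, one_comp, C_pow]
  rw [mul_comm d ℓ, pow_mul]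
  generalize (C μ * (X - C a)) ^ ℓ = z
  rw [mul_pow, show C b * z + C b = C b * (z + 1) by ring, mul_pow]
  ring

namespace IsSuperelliptic

variable {f : K[X]} {n d : ℕ}

/-- The polynomial `v ^ d - f` has `a` as its only root and degree `d ℓ`, so it is
`(e (x - a) ^ ℓ) ^ d`, where `e` is the leading coefficient of `v`. Comparing degrees in
`f = v ^ d - (e (x - a) ^ ℓ) ^ d` shows that `v - e (x - a) ^ ℓ` is constant. -/
theorem eq_pow_sub_pow [IsAlgClosed K] (hf : IsSuperelliptic f n d) {ℓ : ℕ} (hn : n + ℓ = d * ℓ)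
    (hℓ : ℓ ≠ 0) {v : K[X]} (hv : v.natDegree = ℓ) {a b : K}
    (hroot : ∀ α : K, (v ^ d - f).eval α = 0 → α = a ∧ v.eval α = b) :
    ∃ e : K, e ≠ 0 ∧ b ≠ 0 ∧
      f = (C e * (X - C a) ^ ℓ + C b) ^ d - (C e * (X - C a) ^ ℓ) ^ d := by
  have hd := hf.d_ne_zero
  have hv0 : v ≠ 0 := by rintro rfl; exact hℓ hv.symm
  have he : v.leadingCoeff ≠ 0 := leadingCoeff_ne_zero.2 hv0
  have hvd : (v ^ d).natDegree = d * ℓ := by rw [natDegree_pow, hv]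
  have hlt : f.natDegree < (v ^ d).natDegree := by rw [hvd, hf.natDegree_eq]; omega
  have hwd : (v ^ d - f).natDegree = d * ℓ := by
    rw [natDegree_sub_eq_left_of_natDegree_lt hlt, hvd]
  have hwl : (v ^ d - f).leadingCoeff = v.leadingCoeff ^ d := by
    rw [leadingCoeff_sub_of_degree_lt (degree_lt_degree hlt), leadingCoeff_pow]
  have hw := eq_leadingCoeff_mul_pow_of_roots_eq fun α hα => (hroot α hα).1
  rw [hwd, hwl] at hw
  set e := v.leadingCoeff with hedef
  set u := C e * (X - C a) ^ ℓ with hu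
  have hul : u.leadingCoeff = e := by
    rw [hu, leadingCoeff_mul, leadingCoeff_C, ((monic_X_sub_C a).pow ℓ).leadingCoeff, mul_one]
  have hud : u.natDegree = ℓ := by
    rw [hu, natDegree_C_mul he, natDegree_pow, natDegree_X_sub_C, mul_one]
  have hfu : f = v ^ d - u ^ d := by
    rw [hu, mul_pow, ← C_pow, ← pow_mul, mul_comm ℓ d, ← hw]; ring
  have hprod : (∑ i ∈ Finset.range d, v ^ i * u ^ (d - 1 - i)) * (v - u) = f := by
    rw [hfu]; exact (Commute.all v u).geom_sum₂_mul d
  have hdeg := natDegree_geom_sum₂ he hf.cast_ne_zero hv hud rfl hul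
  have hvu : (v - u).natDegree = 0 := by
    have h1 := congrArg natDegree hprod
    have h2 := hf.ne_zero
    rw [← hprod] at h2
    rw [natDegree_mul (left_ne_zero_of_mul h2) (right_ne_zero_of_mul h2), hdeg, hf.natDegree_eq] at h1
    obtain ⟨d', rfl⟩ := Nat.exists_eq_succ_of_ne_zero hd
    simp only [Nat.succ_eq_add_one, Nat.add_sub_cancel, Nat.add_mul] at h1 hn
    omega
  obtain ⟨c, hc⟩ : ∃ c, v - u = C c := ⟨_, eq_C_of_natDegree_eq_zero hvu⟩
  have hvuc : v = u + C c := by rw [← hc]; ring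
  have hcb : c = b := by
    obtain ⟨α, hα⟩ := IsAlgClosed.exists_root (v ^ d - f) (fun h => by
      have := natDegree_eq_of_degree_eq_some h
      rw [hwd] at this
      exact Nat.mul_ne_zero hd hℓ this)
    obtain ⟨rfl, h⟩ := hroot α hα
    rw [← h, hvuc]
    simp [hu, hℓ]
  refine ⟨e, he, ?_, by rw [← hcb, ← hvuc]; exact hfu⟩
  rintro rfl
  apply hf.ne_zero
  rw [hfu, hvuc, hcb]
  simp

/-- If `ℓ` vanished in `K`, so would the derivative of `f`, and every root of `f` would be multiple. -/
theorem cast_ne_zero_of_eq_pow_sub_pow [IsAlgClosed K] (hf : IsSuperelliptic f n d) {ℓ : ℕ}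
    {a b e : K} (h : f = (C e * (X - C a) ^ ℓ + C b) ^ d - (C e * (X - C a) ^ ℓ) ^ d) :
    (ℓ : K) ≠ 0 := by
  intro hℓ
  have hder : derivative f = 0 := by
    have hℓ' : (ℓ : K[X]) = 0 := by rw [← C_eq_natCast, hℓ, C_0]
    rw [h]
    simp [derivative_pow, derivative_mul, hℓ']
  obtain ⟨α, hα⟩ := IsAlgClosed.exists_root f (fun h => by
    rw [degree_eq_natDegree hf.ne_zero, hf.natDegree_eq] at h
    exact hf.n_ne_zero (by exact_mod_cast h))
  exact hf.derivative_eval_ne_zero hα (by rw [hder, eval_zero])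

end IsSuperelliptic

section Model

variable {ℓ d : ℕ}

theorem natDegree_model (hℓ : ℓ ≠ 0) (hd : (d : K) ≠ 0) :
    (-X ^ (d * ℓ) + (X ^ ℓ + 1) ^ d : K[X]).natDegree = (d - 1) * ℓ := by
  have h1 : (X ^ ℓ + 1 : K[X]).natDegree = ℓ := by
    rw [← C_1, natDegree_X_pow_add_C]
  have h2 : (X ^ ℓ + 1 : K[X]).leadingCoeff = 1 := by
    rw [← C_1, leadingCoeff_X_pow_add_C (Nat.pos_of_ne_zero hℓ)]
  have h3 := natDegree_geom_sum₂ (K := K) one_ne_zero hd h1 (natDegree_X_pow ℓ) h2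
    (leadingCoeff_X_pow ℓ)
  have h4 := (Commute.all (X ^ ℓ + 1 : K[X]) (X ^ ℓ)).geom_sum₂_mul d
  rw [add_sub_cancel_left, mul_one, ← pow_mul, mul_comm ℓ d] at h4
  rw [← h3, h4]
  congr 1; ring

theorem nodup_roots_model (hℓ : (ℓ : K) ≠ 0) (hd : (d : K) ≠ 0) :
    (-X ^ (d * ℓ) + (X ^ ℓ + 1) ^ d : K[X]).roots.Nodup := by
  classical
  have hℓ0 : ℓ ≠ 0 := by rintro rfl; simp at hℓ
  have hd0 : d ≠ 0 := by rintro rfl; simp at hd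
  rw [Multiset.nodup_iff_count_le_one]
  intro α
  rw [count_roots]
  by_contra h
  have hne : (-X ^ (d * ℓ) + (X ^ ℓ + 1) ^ d : K[X]) ≠ 0 := by
    intro h0
    rw [h0] at h
    simp at h
  obtain ⟨h1, h2⟩ := (one_lt_rootMultiplicity_iff_isRoot hne).1 (not_le.1 h)
  obtain ⟨k, rfl⟩ := Nat.exists_eq_succ_of_ne_zero hd0
  rw [mul_comm, pow_mul] at h1 h2
  have hα : α ≠ 0 := by
    rintro rfl
    simp [IsRoot.def, hℓ0] at h1
  simp only [IsRoot.def, eval_add, eval_neg, eval_pow, eval_X, eval_one, derivative_add,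
    derivative_neg, derivative_pow, derivative_X, derivative_one, eval_mul, Nat.succ_eq_add_one,
    Nat.add_sub_cancel, eval_C, add_zero, mul_one] at h1 h2
  -- with `z = α ^ ℓ`, the two equations say `(z + 1) ^ d = z ^ d` and `(z + 1) ^ (d-1) = z ^ (d-1)`
  have h3 : (α ^ ℓ + 1) ^ k = (α ^ ℓ) ^ k := by
    have h4 : ((k + 1 : ℕ) : K) * (ℓ * α ^ (ℓ - 1)) * ((α ^ ℓ + 1) ^ k - (α ^ ℓ) ^ k) = 0 := by
      linear_combination h2
    have h5 := (mul_eq_zero.1 h4).resolve_left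
      (mul_ne_zero hd (mul_ne_zero hℓ (pow_ne_zero _ hα)))
    exact sub_eq_zero.1 h5
  rw [pow_succ, pow_succ, h3] at h1
  exact pow_ne_zero k (pow_ne_zero ℓ hα) (by linear_combination h1)

end Model

section Iso

variable {f g : K[X]} {d : ℕ}

theorem root_pow (f : K[X]) (d : ℕ) :
    (AdjoinRoot.root (X ^ d - C f : K[X][X])) ^ d = AdjoinRoot.of _ f := by
  have := AdjoinRoot.eval₂_root (X ^ d - C f : K[X][X])
  rwa [eval₂_sub, eval₂_X_pow, eval₂_C, sub_eq_zero] at this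

theorem eval₂_scale {μ a ρ : K} (h : f = C (ρ ^ d) * g.comp (C μ * (X - C a))) (hρ : ρ ≠ 0) :
    eval₂ ((AdjoinRoot.of (X ^ d - C f : K[X][X])).comp (compRingHom (C μ * (X - C a))))
      (AdjoinRoot.of _ (C ρ⁻¹) * AdjoinRoot.root _) (X ^ d - C g) = 0 := by
  have h2 : C (ρ⁻¹ ^ d) * f = g.comp (C μ * (X - C a)) := by
    rw [h, ← mul_assoc, ← C_mul, ← mul_pow, inv_mul_cancel₀ hρ, one_pow, C_1, one_mul]
  rw [eval₂_sub, eval₂_X_pow, eval₂_C, mul_pow, root_pow, ← map_pow, ← C_pow, ← map_mul, h2]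
  exact sub_self _

/-- The homomorphism of coordinate rings `x ↦ μ (x - a)`, `y ↦ y / ρ`. -/
def scaleHom {μ a ρ : K} (h : f = C (ρ ^ d) * g.comp (C μ * (X - C a))) (hρ : ρ ≠ 0) :
    CoordRing g d →ₐ[K] CoordRing f d where
  toRingHom := AdjoinRoot.lift _ _ (eval₂_scale h hρ)
  commutes' c := by
    refine (AdjoinRoot.lift_of (eval₂_scale h hρ) (x := C c)).trans ?_
    rw [RingHom.comp_apply, coe_compRingHom_apply, C_comp]
    rfl

theorem scaleHom_of {μ a ρ : K} (h : f = C (ρ ^ d) * g.comp (C μ * (X - C a))) (hρ : ρ ≠ 0)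
    (s : K[X]) :
    scaleHom h hρ (AdjoinRoot.of _ s) = AdjoinRoot.of _ (s.comp (C μ * (X - C a))) :=
  AdjoinRoot.lift_of (eval₂_scale h hρ)

theorem scaleHom_root {μ a ρ : K} (h : f = C (ρ ^ d) * g.comp (C μ * (X - C a))) (hρ : ρ ≠ 0) :
    scaleHom h hρ (AdjoinRoot.root _) = AdjoinRoot.of _ (C ρ⁻¹) * AdjoinRoot.root _ :=
  AdjoinRoot.lift_root (eval₂_scale h hρ)

theorem scaleHom_scaleHom {μ a ρ μ' a' ρ' : K} (h : f = C (ρ ^ d) * g.comp (C μ * (X - C a)))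
    (hρ : ρ ≠ 0) (h' : g = C (ρ' ^ d) * f.comp (C μ' * (X - C a'))) (hρ' : ρ' ≠ 0)
    (hx : (C μ * (X - C a)).comp (C μ' * (X - C a')) = X) (hy : ρ * ρ' = 1) :
    (scaleHom h' hρ').comp (scaleHom h hρ) = AlgHom.id K _ := by
  have hof : ∀ s : K[X], scaleHom h' hρ' (scaleHom h hρ (AdjoinRoot.of _ s)) =
      AdjoinRoot.of _ s := fun s => by
    rw [scaleHom_of, scaleHom_of, comp_assoc, hx, comp_X]
  apply AlgHom.coe_ringHom_injective
  apply AdjoinRoot.ringHom_ext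
  · exact RingHom.ext hof
  · change scaleHom h' hρ' (scaleHom h hρ (AdjoinRoot.root _)) = AdjoinRoot.root _
    rw [scaleHom_root, map_mul, scaleHom_of, scaleHom_root, C_comp, ← mul_assoc, ← map_mul, ← C_mul,
      ← mul_inv, hy, inv_one, C_1, map_one, one_mul]

/-- Transport of points along an isomorphism of function fields, by pulling back valuations. -/
def Point.comap (e : FunField g d ≃ₐ[K] FunField f d) (P : Point f d) : Point g d where
  val := P.val.comap (e : FunField g d →+* FunField f d)
  surjective_val := P.surjective_val.comp e.surjective
  val_const c hc := by
    have h : P.val (e (algebraMap K (FunField g d) c)) = 1 := by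
      rw [e.commutes, P.val_const c hc]
    exact h

theorem Point.comap_val (e : FunField g d ≃ₐ[K] FunField f d) (P : Point f d) (z : FunField g d) :
    (P.comap e).val z = P.val (e z) :=
  rfl

/-- The isomorphism of curves induced by an isomorphism of function fields. -/
def CurveIso.ofAlgEquiv (e : FunField g d ≃ₐ[K] FunField f d) : CurveIso f g d where
  toEquiv :=
    { toFun := Point.comap e
      invFun := Point.comap e.symm
      left_inv := fun P => by
        ext z
        rw [Point.comap_val, Point.comap_val, e.apply_symm_apply]
      right_inv := fun P => by
        ext z
        rw [Point.comap_val, Point.comap_val, e.symm_apply_apply] }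
  pullback := e
  val_pullback := Point.comap_val e

/-- Curves whose equations differ by an affine substitution in `x` and a scaling of `y` are
isomorphic. -/
theorem exists_curveIso {μ a ρ : K} (h : f = C (ρ ^ d) * g.comp (C μ * (X - C a))) (hρ : ρ ≠ 0)
    (hμ : μ ≠ 0) : ∃ φ : CurveIso f g d,
      φ.pullback (xFun g d) = algebraMap K _ μ * (xFun f d - algebraMap K _ a) ∧
      φ.pullback (yFun g d) = algebraMap K _ ρ⁻¹ * yFun f d := by
  have hx : (C μ * (X - C a)).comp (C μ⁻¹ * (X - C (-(μ * a)))) = X := by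
    simp only [mul_comp, sub_comp, C_comp, X_comp, C_neg, C_mul]
    have : C μ * C μ⁻¹ = (1 : K[X]) := by rw [← C_mul, mul_inv_cancel₀ hμ, C_1]
    linear_combination (X + C μ * C a) * this
  have hx' : (C μ⁻¹ * (X - C (-(μ * a)))).comp (C μ * (X - C a)) = X := by
    simp only [mul_comp, sub_comp, neg_comp, C_comp, X_comp, C_neg, C_mul]
    have : C μ * C μ⁻¹ = (1 : K[X]) := by rw [← C_mul, mul_inv_cancel₀ hμ, C_1]
    linear_combination X * this
  have h' : g = C (ρ⁻¹ ^ d) * f.comp (C μ⁻¹ * (X - C (-(μ * a)))) := by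
    conv_rhs => rw [h]
    rw [mul_comp, C_comp, comp_assoc, hx, comp_X, ← mul_assoc, ← C_mul, ← mul_pow,
      inv_mul_cancel₀ hρ, one_pow, C_1, one_mul]
  let e : CoordRing g d ≃ₐ[K] CoordRing f d :=
    AlgEquiv.ofAlgHom (scaleHom h hρ) (scaleHom h' (inv_ne_zero hρ))
      (scaleHom_scaleHom h' (inv_ne_zero hρ) h hρ hx' (inv_mul_cancel₀ hρ))
      (scaleHom_scaleHom h hρ h' (inv_ne_zero hρ) hx (mul_inv_cancel₀ hρ))
  refine ⟨CurveIso.ofAlgEquiv (IsFractionRing.algEquivOfAlgEquiv e), ?_, ?_⟩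
  · refine (IsFractionRing.algEquivOfAlgEquiv_algebraMap e _).trans ?_
    change algebraMap (CoordRing f d) (FunField f d) (scaleHom h hρ (AdjoinRoot.of _ X)) = _
    rw [scaleHom_of, X_comp, algebraMap_of_eq_aeval]
    simp
  · refine (IsFractionRing.algEquivOfAlgEquiv_algebraMap e _).trans ?_
    change algebraMap (CoordRing f d) (FunField f d) (scaleHom h hρ (AdjoinRoot.root _)) = _
    rw [scaleHom_root, map_mul, ← algebraMap_eq_coordRing, yFun]

theorem CurveIso.val_symm (φ : CurveIso f g d) (P : Point g d) (z : FunField g d) :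
    P.val z = (φ.toEquiv.symm P).val (φ.pullback z) := by
  rw [← φ.val_pullback, Equiv.apply_symm_apply]

theorem CurveIso.isInfinity {φ : CurveIso f g d} {μ a : K} (hμ : μ ≠ 0)
    (hφ : φ.pullback (xFun g d) = algebraMap K _ μ * (xFun f d - algebraMap K _ a))
    {O : Point f d} (hO : O.IsInfinity) : (φ.toEquiv O).IsInfinity := by
  intro P
  rw [φ.val_symm, hφ, map_mul, Point.val_const _ μ hμ, one_mul, ← Equiv.symm_apply_eq, ← hO]
  set R := φ.toEquiv.symm P
  have ha := R.val_const_le_one a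
  constructor
  · intro h
    by_contra h'
    exact absurd (R.val.map_sub_le (not_lt.1 h') ha) (not_le.2 h)
  · intro h
    rwa [R.val.map_sub_eq_of_lt_left (ha.trans_lt h)]

theorem CurveIso.isAffine {φ : CurveIso f g d} {μ a ρ : K} (hμ : μ ≠ 0) (hρ : ρ ≠ 0)
    (hφx : φ.pullback (xFun g d) = algebraMap K _ μ * (xFun f d - algebraMap K _ a))
    (hφy : φ.pullback (yFun g d) = algebraMap K _ ρ⁻¹ * yFun f d)
    {P : Point f d} (hP : P.IsAffine a ρ) : (φ.toEquiv P).IsAffine 0 1 := by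
  intro Q
  have h1 : algebraMap K (FunField f d) ρ⁻¹ * yFun f d - 1 =
      algebraMap K _ ρ⁻¹ * (yFun f d - algebraMap K _ ρ) := by
    rw [mul_sub, ← map_mul, inv_mul_cancel₀ hρ, map_one]
  rw [map_zero, sub_zero, map_one, φ.val_symm, φ.val_symm, map_sub, map_one, hφx, hφy, h1, map_mul,
    map_mul, Point.val_const _ μ hμ, Point.val_const _ _ (inv_ne_zero hρ), one_mul, one_mul,
    ← Equiv.symm_apply_eq, ← hP]

end Iso

/-! ### The model curve -/

namespace IsSuperelliptic

variable {n d ℓ : ℕ} [IsAlgClosed K]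

/-- If `y ^ d = w(x) ^ d - x ^ (d ℓ)` with `w` of degree `ℓ` and `w(0) = 1`, then the function
`y - w(x)` divides `x ^ (d ℓ)` in the coordinate ring and vanishes at `Q = (0, 1)` only, so its
divisor is `d ℓ (Q - O)`. -/
theorem nsmul_jacClass_eq_zero_of_eq {f w : K[X]} (hf : IsSuperelliptic f n d)
    (hfw : f = -X ^ (d * ℓ) + w ^ d) (hw0 : w.eval 0 = 1) (hwdeg : w.natDegree = ℓ)
    (hn : n < d * ℓ) (hℓ : ℓ ≠ 0) {O Q : Point f d} (hO : O.IsInfinity)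
    (hQ : Q.IsAffine 0 1) (hQx : Q.val (xFun f d) = WithZero.exp (-1)) :
    (d * ℓ) • jacClass O Q = 0 := by
  have := hf.isDomain
  have hd := hf.d_ne_zero
  obtain ⟨hQ0, hQ1⟩ := (hQ Q).2 rfl
  obtain ⟨hOx, hOy, -⟩ := hf.val_of_isInfinity hO
  have hwne : w ≠ 0 := by rintro rfl; simp at hw0
  have hyd := yFun_pow f d
  have hfx := congrArg (aeval (xFun f d)) hfw
  set x := xFun f d with hx
  set y := yFun f d with hy
  set U := ∑ i ∈ Finset.range d, y ^ i * aeval x w ^ (d - 1 - i) with hU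
  have hmul : U * (y - aeval x w) = -x ^ (d * ℓ) := by
    rw [hU, (Commute.all y (aeval x w)).geom_sum₂_mul d, hyd, hfx]
    simp
  have hxlt : ∀ R : Point f d, R.val x < 1 → R.val (aeval x w - 1) < 1 := fun R hR => by
    have h1 := val_aeval_sub_le R.val_const (z := x) (b := 0) (by simpa using hR) w
    rw [hw0, map_zero, map_one, sub_zero] at h1
    exact h1.trans_lt hR
  -- at `Q` both `y` and `w(x)` reduce to `1`, so the cofactor `U` reduces to `d ≠ 0`
  have hQU : Q.val U = 1 := by
    have h1 : Q.val (U - algebraMap K _ (d : K)) < 1 := by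
      have h2 : U - algebraMap K _ (d : K) =
          ∑ i ∈ Finset.range d, (y ^ i * aeval x w ^ (d - 1 - i) - 1) := by
        rw [Finset.sum_sub_distrib, hU]; simp
      rw [h2]
      refine Q.val.map_sum_lt one_ne_zero fun i _ => ?_
      have h3 : ∀ (z : FunField f d), Q.val (z - 1) < 1 → ∀ k : ℕ, Q.val (z ^ k - 1) < 1 := by
        intro z hz k
        have h4 := val_aeval_sub_le Q.val_const (z := z) (b := 1) (by simpa using hz) (X ^ k)
        simp only [map_pow, aeval_X, eval_pow, eval_X, one_pow, map_one] at h4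
        exact h4.trans_lt hz
      have h5 := h3 y (by simpa using hQ1) i
      have h6 := h3 (aeval x w) (hxlt Q (by simpa using hQ0)) (d - 1 - i)
      have h7 : Q.val (aeval x w ^ (d - 1 - i)) ≤ 1 := by
        rw [map_pow]
        exact pow_le_one' (val_aeval_le_one Q.val_const
          (val_le_one_of_val_sub_lt_one Q.val_const hQ0) w) _
      rw [show y ^ i * aeval x w ^ (d - 1 - i) - 1 =
        (y ^ i - 1) * aeval x w ^ (d - 1 - i) + (aeval x w ^ (d - 1 - i) - 1) by ring]
      refine Q.val.map_add_lt ?_ h6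
      rw [map_mul]
      exact (mul_le_of_le_one_right' h7).trans_lt h5
    have h2 := Q.val.map_add_eq_of_lt_right (x := U - algebraMap K _ (d : K))
      (y := algebraMap K _ (d : K)) (by rwa [Q.val_const _ hf.cast_ne_zero])
    rwa [sub_add_cancel, Q.val_const _ hf.cast_ne_zero] at h2
  have hQh : Q.val (y - aeval x w) = WithZero.exp (-1) ^ (d * ℓ) := by
    have h1 := congrArg Q.val hmul
    rwa [map_mul, hQU, one_mul, Valuation.map_neg, map_pow, hQx] at h1
  have hh0 : y - aeval x w ≠ 0 := by
    rw [← Q.val.ne_zero_iff, hQh]; exact pow_ne_zero _ WithZero.exp_ne_zero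
  rw [nsmul_jacClass_eq_zero_iff (ne_of_isInfinity hO hQ0)]
  refine ⟨Units.mk0 _ hh0, ?_, ?_, fun R hRQ hRO => ?_⟩
  · rw [Units.val_mk0, hQh, ← WithZero.exp_nsmul]; simp
  · have h1 : O.val (aeval x w) = WithZero.exp ((d * ℓ : ℕ) : ℤ) := by
      rw [val_aeval_of_one_lt O.val_const ((hO O).2 rfl) hwne, hOx, hwdeg, ← WithZero.exp_nsmul]
      congr 1
      simp [mul_comm]
    rw [Units.val_mk0, Valuation.map_sub_eq_of_lt_right, h1]
    rw [h1, hOy, WithZero.exp_lt_exp]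
    exact_mod_cast hn
  · rw [Units.val_mk0]
    have hRx := val_xFun_le_one_of_ne hO hRO
    have hRle : ∀ A : CoordRing f d, R.val (algebraMap _ _ A) ≤ 1 := val_coordRing_le_one hd hRx
    have hRy : R.val y ≤ 1 := hRle _
    have hRw : R.val (aeval x w) ≤ 1 := val_aeval_le_one R.val_const hRx w
    by_contra hne
    have hlt : R.val (y - aeval x w) < 1 := lt_of_le_of_ne (R.val.map_sub_le hRy hRw) hne
    have hRU : R.val U ≤ 1 := R.val.map_sum_le fun i _ => by
      rw [map_mul, map_pow, map_pow]
      exact mul_le_one' (pow_le_one' hRy _) (pow_le_one' hRw _)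
    have h1 : R.val x < 1 := by
      rw [← pow_lt_one_iff (Nat.mul_ne_zero hd hℓ), ← map_pow, ← Valuation.map_neg, ← hmul, map_mul]
      exact (mul_le_of_le_one_left' hRU).trans_lt hlt
    refine hRQ ((hQ R).1 ⟨by simpa using h1, ?_⟩)
    have h2 := R.val.map_add_lt hlt (hxlt R h1)
    rw [map_one]
    rwa [sub_add_sub_cancel] at h2

/-- The point `(0, 1)` of the model has order exactly `d ℓ`: a function realizing a smaller order
would have a pole of order less than `n`, hence be a polynomial in `x`. -/
theorem exists_hasOrder_model
    (hf : IsSuperelliptic (-X ^ (d * ℓ) + (X ^ ℓ + 1) ^ d : K[X]) n d) (hn : n + ℓ = d * ℓ)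
    (hℓ : ℓ ≠ 0) (hd : 3 ≤ d) :
    ∃ Q : Point (-X ^ (d * ℓ) + (X ^ ℓ + 1) ^ d : K[X]) d, Q.IsAffine 0 1 ∧
      Q.HasOrder (d * ℓ) := by
  have heval : (-X ^ (d * ℓ) + (X ^ ℓ + 1) ^ d : K[X]).eval 0 = 1 := by
    simp [hℓ, hf.d_ne_zero]
  obtain ⟨O, hO, -⟩ := hf.exists_isInfinity
  obtain ⟨Q, hQ, hQx, -⟩ := hf.exists_isAffine (a := 0) (b := 1) one_ne_zero (by rw [heval, one_pow])
  refine ⟨Q, hQ, O, hO, ?_⟩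
  have hQO : Q ≠ O := ne_of_isInfinity hO ((hQ Q).2 rfl).1
  have hdvd := addOrderOf_dvd_of_nsmul_eq_zero
    (hf.nsmul_jacClass_eq_zero_of_eq (w := X ^ ℓ + 1) rfl (by simp [hℓ])
      (by rw [← C_1, natDegree_X_pow_add_C]) (by omega) hℓ hO hQ (by simpa using hQx))
  have hpos : 0 < d * ℓ := Nat.mul_pos (by omega) (Nat.pos_of_ne_zero hℓ)
  by_contra hne
  obtain ⟨p, hpd, hpk, hpR⟩ := hf.exists_poleOrder_eq hO hQO (addOrderOf_nsmul_eq_zero _)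
  set m := addOrderOf (jacClass O Q) with hm
  have hm0 : 0 < m := Nat.pos_of_dvd_of_pos hdvd hpos
  -- a proper divisor of `d ℓ` is at most half of it
  have h2m : 2 * m ≤ d * ℓ := by
    obtain ⟨c, hc⟩ := hdvd
    have hc2 : 2 ≤ c := by
      by_contra h
      interval_cases c <;> omega
    rw [hc, mul_comm]
    exact Nat.mul_le_mul_left m hc2
  have h3 : 3 * ℓ ≤ d * ℓ := Nat.mul_le_mul_right ℓ hd
  -- `m ≤ d ℓ / 2 < n`, and `y` has pole order `n`
  have hp0 : p.natDegree = 0 := by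
    by_contra h
    have h1 := le_poleOrder n d (p := p) (i := p.natDegree) (by
      rw [coeff_natDegree, leadingCoeff_ne_zero]
      rintro rfl
      exact h natDegree_zero)
    have h4 : n * 1 ≤ n * p.natDegree := Nat.mul_le_mul_left n (by omega)
    omega
  obtain ⟨s, rfl⟩ : ∃ s, p = C s := ⟨_, eq_C_of_natDegree_eq_zero hp0⟩
  have hs : s.natDegree ≠ 0 := by
    intro hs
    have : poleOrder n d (C s) = 0 := by
      rw [poleOrder, ← bot_eq_zero, Finset.sup_eq_bot_iff]
      intro i hi
      have hi0 : i = 0 := by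
        by_contra h
        exact (mem_support_iff.1 hi) (coeff_C_of_ne_zero h)
      subst hi0
      simp [hs]
    omega
  have h0 := hf.eval_eq_zero_of_val_aeval_xFun hO hQ hs fun R hRP hRO => by
    rw [← hpR R hRP hRO, AdjoinRoot.mk_C, algebraMap_of_eq_aeval]
  rw [heval] at h0
  exact one_ne_zero h0

/-- If `n = (d - 1) ℓ`, the existence of a point of order `d ℓ` determines the equation up to an
affine change of `x` and a scaling of `y`. -/
theorem exists_eq_comp_of_hasOrder {f : K[X]} (hf : IsSuperelliptic f n d) (hn : n + ℓ = d * ℓ)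
    (hℓd : ℓ < d) (hℓ : 2 ≤ ℓ) {P : Point f d} {a b : K} (hP : P.IsAffine a b)
    (hord : P.HasOrder (d * ℓ)) :
    (ℓ : K) ≠ 0 ∧ b ≠ 0 ∧ ∃ μ : K, μ ≠ 0 ∧
      f = C (b ^ d) * (-X ^ (d * ℓ) + (X ^ ℓ + 1) ^ d : K[X]).comp (C μ * (X - C a)) := by
  obtain ⟨O, hO, hord⟩ := hord
  obtain ⟨v, hv, hroot⟩ := hf.exists_section hn hℓd hℓ hO hP hord
  obtain ⟨e, he, hb, h⟩ := hf.eq_pow_sub_pow hn (by omega) hv hroot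
  exact ⟨hf.cast_ne_zero_of_eq_pow_sub_pow h, hb, exists_eq_comp (by omega) he hb h⟩

end IsSuperelliptic

section BaseField

variable {K₀ : Type*} [Field K₀] [Algebra K₀ K]

theorem ringChar_dvd_iff (K : Type*) [Field K] [Algebra K₀ K] (m : ℕ) :
    ringChar K₀ ∣ m ↔ (m : K) = 0 := by
  rw [← ringChar.spec, ← map_natCast (algebraMap K₀ K), map_eq_zero]

theorem IsAdmissible.isSuperelliptic {n d : ℕ} {f : K₀[X]} (hf : IsAdmissible K n f) (hd : 2 ≤ d)
    (hcop : n.Coprime d) (hchar : ¬ ringChar K ∣ d) :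
    IsSuperelliptic (f.map (algebraMap K₀ K)) n d where
  natDegree_eq := by rw [natDegree_map, hf.1]
  nodup_roots := hf.2
  two_le := hd
  coprime := hcop
  cast_ne_zero h := hchar ((ringChar.spec K d).1 h)

theorem map_fZero (n d : ℕ) : (fZero K₀ n d).map (algebraMap K₀ K) =
    -X ^ (d * ellZero n d) + (X ^ ellZero n d + 1) ^ d := by
  simp [fZero, mZero]

/-- A rational point of order greater than one is an affine point. -/
theorem Point.IsRational.exists_isAffine {f : K[X]} {d m : ℕ} {P : Point f d}
    (hP : P.IsRational K₀) (hord : P.HasOrder m) (hm : m ≠ 1) :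
    ∃ a b : K, P.IsAffine a b := by
  rcases hP with hP | ⟨a, b, h⟩
  · obtain ⟨O, hO, hord⟩ := hord
    obtain rfl : P = O := (hO P).1 ((hP P).2 rfl)
    rw [jacClass_self, addOrderOf_zero] at hord
    exact absurd hord.symm hm
  · exact ⟨_, _, h⟩

end BaseField

/-- The numerical content of `n - m₀ + ℓ₀ = 0`: here `n = (d - 1) ℓ₀` with `2 ≤ ℓ₀ < d`, where
`ℓ₀ ≠ d` because `n` and `d` are coprime. -/
theorem ellZero_bounds {n d : ℕ} (hd : 2 ≤ d) (hdn : d < n) (hcop : n.Coprime d)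
    (hzero : (n : ℤ) - (mZero n d : ℤ) + (ellZero n d : ℤ) = 0) :
    n + ellZero n d = d * ellZero n d ∧ ellZero n d < d ∧ 2 ≤ ellZero n d := by
  have h1 : n + ellZero n d = d * ellZero n d := by
    rw [mZero] at hzero
    zify
    push_cast at hzero
    linarith
  have h2 : d * ellZero n d ≤ n + d := Nat.mul_div_le (n + d) d
  have h3 : 2 ≤ ellZero n d := (Nat.le_div_iff_mul_le (by omega)).2 (by omega)
  refine ⟨h1, lt_of_le_of_ne (by omega) fun h => ?_, h3⟩
  rw [h] at h1
  have : d ∣ n := (Nat.dvd_add_left (dvd_refl d)).1 (h1 ▸ dvd_mul_right d d)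
  have := Nat.Coprime.eq_one_of_dvd hcop.symm this
  omega

end CyclicCover

end

theorem mainTheorem1 {K₀ K : Type*} [Field K₀] [PerfectField K₀] [Field K] [IsAlgClosed K]
    [Algebra K₀ K] (n d : ℕ) (hd : 2 ≤ d) (hdn : d < n) (hcop : n.Coprime d)
    (hchar : ¬ ringChar K ∣ d)
    (hzero : (n : ℤ) - (mZero n d : ℤ) + (ellZero n d : ℤ) = 0) :
    (CyclicCover.IsReachable K₀ K n d (mZero n d) ↔ ¬ ringChar K₀ ∣ ellZero n d) ∧
    (¬ ringChar K₀ ∣ ellZero n d →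
      CyclicCover.IsAdmissible K n (CyclicCover.fZero K₀ n d) ∧
      ∃ Q : CyclicCover.Point ((CyclicCover.fZero K₀ n d).map (algebraMap K₀ K)) d,
        Q.IsAffine 0 1 ∧ Q.IsRational K₀ ∧ Q.HasOrder (mZero n d)) ∧
    (¬ ringChar K₀ ∣ ellZero n d →
      ∀ f : Polynomial K₀, CyclicCover.IsAdmissible K n f →
      ∀ P : CyclicCover.Point (f.map (algebraMap K₀ K)) d,
        P.IsRational K₀ → P.HasOrder (mZero n d) →
        ∃ φ : CyclicCover.CurveIso (f.map (algebraMap K₀ K))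
            ((CyclicCover.fZero K₀ n d).map (algebraMap K₀ K)) d,
          (∃ O : CyclicCover.Point (f.map (algebraMap K₀ K)) d,
            O.IsInfinity ∧ (φ.toEquiv O).IsInfinity) ∧
          (φ.toEquiv P).IsAffine 0 1) := by
  obtain ⟨hn, hℓd, hℓ⟩ := CyclicCover.ellZero_bounds hd hdn hcop hzero
  have hdK : (d : K) ≠ 0 := fun h => hchar ((ringChar.spec K d).1 h)
  have hm : mZero n d ≠ 1 := by
    have : d * 1 ≤ d * ellZero n d := Nat.mul_le_mul_left d (by omega)
    rw [mZero]
    omega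
  have hmodel : ¬ ringChar K₀ ∣ ellZero n d →
      CyclicCover.IsAdmissible K n (CyclicCover.fZero K₀ n d) ∧
      ∃ Q : CyclicCover.Point ((CyclicCover.fZero K₀ n d).map (algebraMap K₀ K)) d,
        Q.IsAffine 0 1 ∧ Q.IsRational K₀ ∧ Q.HasOrder (mZero n d) := by
    intro hc
    rw [CyclicCover.ringChar_dvd_iff K] at hc
    have hadm : CyclicCover.IsAdmissible K n (CyclicCover.fZero K₀ n d) := by
      constructor
      · rw [← Polynomial.natDegree_map (algebraMap K₀ K), CyclicCover.map_fZero,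
          CyclicCover.natDegree_model (by omega) hdK, Nat.sub_mul]
        omega
      · rw [CyclicCover.map_fZero]
        exact CyclicCover.nodup_roots_model hc hdK
    have hf := hadm.isSuperelliptic hd hcop hchar
    refine ⟨hadm, ?_⟩
    rw [CyclicCover.map_fZero] at hf ⊢
    obtain ⟨Q, hQ, hQm⟩ := hf.exists_hasOrder_model hn (by omega) (by omega)
    exact ⟨Q, hQ, Or.inr ⟨0, 1, by rwa [map_zero, map_one]⟩, hQm⟩
  refine ⟨⟨?_, fun hc => ?_⟩, hmodel, ?_⟩
  · rintro ⟨-, f, hadm, P, hP, hord⟩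
    rw [CyclicCover.ringChar_dvd_iff K]
    obtain ⟨a, b, hP⟩ := hP.exists_isAffine hord hm
    exact ((hadm.isSuperelliptic hd hcop hchar).exists_eq_comp_of_hasOrder hn hℓd hℓ hP hord).1
  · obtain ⟨hadm, Q, -, hQ, hQm⟩ := hmodel hc
    refine ⟨?_, _, hadm, Q, hQ, hQm⟩
    have : d * 1 ≤ d * ellZero n d := Nat.mul_le_mul_left d (by omega)
    rw [mZero]
    omega
  · intro _ f hadm P hP hord
    obtain ⟨a, b, hP⟩ := hP.exists_isAffine hord hm
    have hf := hadm.isSuperelliptic hd hcop hchar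
    obtain ⟨-, hb, μ, hμ, h⟩ := hf.exists_eq_comp_of_hasOrder hn hℓd hℓ hP hord
    rw [← CyclicCover.map_fZero (K₀ := K₀)] at h
    obtain ⟨φ, hφx, hφy⟩ := CyclicCover.exists_curveIso h hb hμ
    obtain ⟨O, hO, -⟩ := hf.exists_isInfinity
    exact ⟨φ, ⟨O, hO, CyclicCover.CurveIso.isInfinity hμ hφx hO⟩,
      CyclicCover.CurveIso.isAffine hμ hb hφx hφy hP⟩
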